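/- All graphs are finite and simple. For an integer $p\ge 1$, a vertex coloring $\varphi$ of a graph $G$ is $p$-centered if for every non-empty connected subgraph $H$ of $G$, either $\varphi$ uses more than $p$ colors on $H$ or some color appears exactly once on $H$. A tree-decomposition $(T,(B_t)_{t\in V(T)})$ of $G$ consists of a tree $T$ and bags $B_t\subseteq V(G)$ such that both ends of each edge of $G$ lie in a common bag, and for every vertex $v$ of $G$ the set $\{t : v\in B_t\}$ induces a non-empty subtree of $T$. For $k\ge 1$ it is $k$-simple if every bag has at most $k+1$ vertices and every set $X\subseteq V(G)$ with $|X|=k$ satisfies $X\subseteq B_t$ for at most two nodes $t$. The simple treewidth of $G$ is the least integer $k\ge 1$ such that $G$ has a $k$-simple tree-decomposition. Theorem. Let $k\ge 2$ be a fixed integer. (i) There is a constant $C>0$, depending only on $k$, such that for every integer $p\ge 2$ every graph of simple treewidth at most $k$ admits a $p$-centered coloring with at most $C\,p^{k-1}\log p$ colors. (ii) There is a constant $c>0$, depending only on $k$, such that for every integer $p\ge 2$ there is a graph of simple treewidth $k$ for which every $p$-centered coloring uses at least $c\,p^{k-1}\log p$ colors. -/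

import Mathlib

namespace SimpleGraph

/-- A vertex coloring `φ` of `G` is `p`-centered if for every (non-empty) connected subgraph `H`
of `G`, either `φ` uses more than `p` colors on `H`, or some color appears exactly once on `H`. -/
def IsCenteredColoring {V C : Type*} (G : SimpleGraph V) (p : ℕ) (φ : V → C) : Prop :=
  ∀ H : G.Subgraph, H.Connected →
    (p : ℕ∞) < (φ '' H.verts).encard ∨ ∃ c : C, ∃! v : V, v ∈ H.verts ∧ φ v = c

/-- A tree-decomposition of `G` whose tree has node set `ι`. -/
structure TreeDecomposition {V : Type*} (G : SimpleGraph V) (ι : Type*) where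
  /-- the decomposition tree -/
  tree : SimpleGraph ι
  isTree : tree.IsTree
  /-- the bags -/
  bag : ι → Set V
  edge_mem : ∀ u v : V, G.Adj u v → ∃ t : ι, u ∈ bag t ∧ v ∈ bag t
  /-- the nodes whose bag contains `v` induce a non-empty subtree -/
  connected : ∀ v : V, (tree.induce {t : ι | v ∈ bag t}).Connected

/-- A tree-decomposition is `k`-simple if it has width at most `k` (bags have at most `k + 1`
vertices) and every set of exactly `k` vertices is contained in the bags of at most two nodes. -/
def TreeDecomposition.IsSimple {V ι : Type*} {G : SimpleGraph V} (D : G.TreeDecomposition ι)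
    (k : ℕ) : Prop :=
  (∀ t : ι, (D.bag t).encard ≤ k + 1) ∧
    ∀ X : Finset V, X.card = k → {t : ι | (X : Set V) ⊆ D.bag t}.encard ≤ 2

/-- `G` has a `k`-simple tree-decomposition (over a finite tree). -/
def HasSimpleTreeDecomposition {V : Type*} (G : SimpleGraph V) (k : ℕ) : Prop :=
  ∃ (ι : Type) (_ : Finite ι) (D : G.TreeDecomposition ι), D.IsSimple k

/-- The simple treewidth of `G`: the least integer `k ≥ 1` such that `G` has a `k`-simple
tree-decomposition (and `⊤` if there is none, which does not happen for finite graphs). -/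
noncomputable def simpleTreewidth {V : Type*} (G : SimpleGraph V) : ℕ∞ :=
  ⨅ (k : ℕ) (_ : 1 ≤ k ∧ G.HasSimpleTreeDecomposition k), (k : ℕ∞)

end SimpleGraph

/-! Upper bound. Making every bag of a `k`-simple tree-decomposition a clique gives a chordal
supergraph with an elimination ordering, in which cliques have at most `k + 1` vertices and a
`k`-clique has at most two common neighbours (`exists_elimOrdered_simpleOn`). Split it into distance
layers. A clique inside a layer has a common neighbour one layer below, so every layer satisfies the
same condition with `k - 1` (`simpleOn_layer`), and a connected set meets its lowest layer in a
connected set (`connOn_lowest`). Pairing colourings of the layers with the layer number modulo `p +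
1` therefore costs a factor `p + 1`, and `k - 2` rounds lead to `k = 2`. There the layers are linear
forests (`exists_centeredOn_of_forest_layers`): odd positions on the paths receive a greedy palette
of `O(p)` colours, which makes long paths show more than `p` colours, so that on even positions a
ruler sequence with `O(log p)` colours, paired with the layer modulo `p + 1`, only has to handle
paths of length `O(p)`.

Lower bound. Take all reduced words over `k + 1` letters, two being adjacent when one lies in the
bag of the other. Truncations at bounded length have simple treewidth `k`
(`simpleTreewidth_wordGraph`), and the infinite graph contains neighbourhoods nested to depth `k -
1` that end in rays (`Rich`, `rich_wordCone`). A colour that can be attached twice to a small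
connected set at little cost in new colours cannot be the unique colour there; `Available` records
such colours. Halving a ray segment of length `2 ^ n` finds a vertex that misses `n` colours
(`exists_hub`), and every neighbourhood level multiplies this number by `s`
(`exists_recurrent_of_rich`). This forces `s ^ (k - 1) * n` colours, with `s` of order `p` and `n`
of order `log p`. Compactness (`exists_finCenteredOn_of_exhaustion`) brings the bound down to a
finite truncation. -/

namespace SimpleGraph

/-! ### Connectivity of vertex sets through cuts, and centered colourings -/

/-- Every cut of `S` into two non-empty parts is crossed by an edge of `G`. -/
def ConnOn {V : Type*} (G : SimpleGraph V) (S : Set V) : Prop :=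
  ∀ A ⊆ S, A.Nonempty → (S \ A).Nonempty → ∃ a ∈ A, ∃ b ∈ S \ A, G.Adj a b

namespace ConnOn

variable {V : Type*} {G : SimpleGraph V} {S T : Set V}

lemma singleton (x : V) : G.ConnOn {x} := by
  rintro A hA ⟨a, ha⟩ ⟨b, hb, hbA⟩
  have h1 : a = x := hA ha
  have h2 : b = x := hb
  exact absurd ((h1.trans h2.symm) ▸ ha) hbA

lemma mono {G' : SimpleGraph V} (h : G ≤ G') (hS : G.ConnOn S) : G'.ConnOn S := by
  intro A hA h1 h2
  obtain ⟨a, ha, b, hb, hab⟩ := hS A hA h1 h2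
  exact ⟨a, ha, b, hb, h hab⟩

lemma union (hS : G.ConnOn S) (hT : G.ConnOn T) (h : (S ∩ T).Nonempty) : G.ConnOn (S ∪ T) := by
  have key : ∀ A : Set V, ∀ S T : Set V, G.ConnOn S → G.ConnOn T → (∃ x ∈ S, x ∈ T ∧ x ∈ A) →
      ((S ∪ T) \ A).Nonempty → ∃ a ∈ A, ∃ b ∈ (S ∪ T) \ A, G.Adj a b := by
    rintro A S T hS hT ⟨x, xS, xT, xA⟩ ⟨y, hy, yA⟩
    rcases hy with hy | hy
    · obtain ⟨a, ha, b, hb, hab⟩ := hS (A ∩ S) Set.inter_subset_right ⟨x, xA, xS⟩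
        ⟨y, hy, fun h => yA h.1⟩
      exact ⟨a, ha.1, b, ⟨Or.inl hb.1, fun h => hb.2 ⟨h, hb.1⟩⟩, hab⟩
    · obtain ⟨a, ha, b, hb, hab⟩ := hT (A ∩ T) Set.inter_subset_right ⟨x, xA, xT⟩
        ⟨y, hy, fun h => yA h.1⟩
      exact ⟨a, ha.1, b, ⟨Or.inr hb.1, fun h => hb.2 ⟨h, hb.1⟩⟩, hab⟩
  obtain ⟨x, xS, xT⟩ := h
  intro A hA h1 h2
  by_cases xA : x ∈ A
  · exact key A S T hS hT ⟨x, xS, xT, xA⟩ h2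
  · have h3 : ((S ∪ T) \ ((S ∪ T) \ A)).Nonempty := by
      obtain ⟨a, ha⟩ := h1
      exact ⟨a, hA ha, fun h => h.2 ha⟩
    obtain ⟨a, ha, b, hb, hab⟩ := key ((S ∪ T) \ A) S T hS hT ⟨x, xS, xT, Or.inl xS, xA⟩ h3
    refine ⟨b, ?_, a, ha, hab.symm⟩
    by_contra hbA
    exact hb.2 ⟨hb.1, hbA⟩

lemma pair {x y : V} (h : G.Adj x y) : G.ConnOn {x, y} := by
  rintro A hA ⟨a, ha⟩ ⟨b, hb, hbA⟩
  refine ⟨a, ha, b, ⟨hb, hbA⟩, ?_⟩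
  have hne : a ≠ b := fun e => hbA (e ▸ ha)
  rcases hA ha with rfl | rfl <;> rcases hb with rfl | rfl
  · exact absurd rfl hne
  · exact h
  · exact h.symm
  · exact absurd rfl hne

lemma insert_adj {x y : V} (hS : G.ConnOn S) (hx : x ∈ S) (h : G.Adj x y) :
    G.ConnOn (insert y S) := by
  have := hS.union (pair h) ⟨x, hx, by simp⟩
  convert this using 1
  ext z
  simp only [Set.mem_insert_iff, Set.mem_union, Set.mem_singleton_iff]
  constructor
  · tauto
  · rintro (h | rfl | h)
    · exact Or.inr h
    · exact Or.inr hx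
    · exact Or.inl h

/-- Removing a vertex whose neighbours in `S` form a clique keeps `S` connected. -/
lemma diff_simplicial {x : V} (hS : G.ConnOn S)
    (h : ∀ a ∈ S, ∀ b ∈ S, a ≠ b → G.Adj a x → G.Adj b x → G.Adj a b) :
    G.ConnOn (S \ {x}) := by
  intro A hA h1 h2
  by_contra! hno
  have hAS : A ⊆ S := fun a ha => (hA ha).1
  have hxA : x ∉ A := fun hx => (hA hx).2 rfl
  obtain ⟨y, hy, hyA⟩ := h2
  obtain ⟨a, ha, b, hb, hab⟩ := hS A hAS h1 ⟨y, hy.1, hyA⟩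
  have hbx : b = x := by
    by_contra hbx
    exact hno a ha b ⟨⟨hb.1, hbx⟩, hb.2⟩ hab
  subst hbx
  -- Every edge of `S` leaving `A` ends in the removed vertex, now called `b`. Once `b` is moved
  -- across the cut, a crossing edge that starts at `b` makes `a` and `d` two neighbours of `b`,
  -- hence adjacent.
  obtain ⟨c, hc, d, hd, hcd⟩ := hS (insert b A) (Set.insert_subset hb.1 hAS) ⟨a, Or.inr ha⟩
    ⟨y, hy.1, fun h => h.elim (fun h => hy.2 h) hyA⟩
  have hdx : d ≠ b := fun h => hd.2 (Or.inl h)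
  have hdA : d ∉ A := fun h => hd.2 (Or.inr h)
  rcases hc with rfl | hc
  · have had : a ≠ d := fun e => hdA (e ▸ ha)
    exact hno a ha d ⟨⟨hd.1, hdx⟩, hdA⟩ (h a (hAS ha) d hd.1 had hab hcd.symm)
  · exact hno c hc d ⟨⟨hd.1, hdx⟩, hdA⟩ hcd

lemma exists_crossing {f : V → Prop} (hS : G.ConnOn S) (h1 : ∃ a ∈ S, f a) (h2 : ∃ b ∈ S, ¬ f b) :
    ∃ a ∈ S, ∃ b ∈ S, f a ∧ ¬ f b ∧ G.Adj a b := by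
  obtain ⟨a, ha, hfa⟩ := h1
  obtain ⟨b, hb, hfb⟩ := h2
  obtain ⟨c, hc, d, hd, hcd⟩ := hS {x ∈ S | f x} (fun x hx => hx.1) ⟨a, ha, hfa⟩
    ⟨b, hb, fun h => hfb h.2⟩
  exact ⟨c, hc.1, d, hd.1, hc.2, fun h => hd.2 ⟨hd.1, h⟩, hcd⟩

end ConnOn

variable {V : Type*} {G : SimpleGraph V}

lemma Subgraph.Connected.connOn {H : G.Subgraph} (h : H.Connected) : G.ConnOn H.verts := by
  rintro A hA ⟨a, ha⟩ ⟨b, hb, hbA⟩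
  obtain ⟨w⟩ := h.preconnected ⟨a, hA ha⟩ ⟨b, hb⟩
  obtain ⟨d, -, h1, h2⟩ := w.exists_boundary_dart {x | (x : V) ∈ A} ha hbA
  exact ⟨d.fst, h1, d.snd, ⟨d.snd.2, h2⟩, H.adj_sub d.adj⟩

lemma connOn_of_induce_connected {S : Set V} (h : (G.induce S).Connected) : G.ConnOn S := by
  rintro A hA ⟨a, ha⟩ ⟨b, hb, hbA⟩
  obtain ⟨w⟩ := h.preconnected ⟨a, hA ha⟩ ⟨b, hb⟩
  obtain ⟨d, -, h1, h2⟩ := w.exists_boundary_dart {x | (x : V) ∈ A} ha hbA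
  exact ⟨d.fst, h1, d.snd, ⟨d.snd.2, h2⟩, d.adj⟩

lemma ConnOn.induce_connected {S : Set V} (h : G.ConnOn S) (hne : S.Nonempty) :
    (G.induce S).Connected := by
  have : Nonempty S := hne.to_subtype
  rw [connected_iff_exists_forall_reachable]
  obtain ⟨a, ha⟩ := hne
  refine ⟨⟨a, ha⟩, ?_⟩
  by_contra! hno
  obtain ⟨⟨b, hb⟩, hab⟩ := hno
  obtain ⟨c, hc, d, hd, hcd⟩ := h {x | ∃ hx : x ∈ S, (G.induce S).Reachable ⟨a, ha⟩ ⟨x, hx⟩}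
    (fun x hx => hx.1) ⟨a, ha, Reachable.refl _⟩ ⟨b, hb, fun h => hab h.2⟩
  obtain ⟨hcS, hc⟩ := hc
  refine hd.2 ⟨hd.1, hc.trans (Adj.reachable ?_)⟩
  exact hcd

lemma ConnOn.exists_subgraph {S : Set V} (h : G.ConnOn S) (hne : S.Nonempty) :
    ∃ H : G.Subgraph, H.Connected ∧ H.verts = S :=
  ⟨(⊤ : G.Subgraph).induce S, (connected_induce_iff).1 (h.induce_connected hne), rfl⟩

/-- The centered colouring condition for the connected vertex sets contained in `L`. -/
def CenteredOn {C : Type*} (G : SimpleGraph V) (p : ℕ) (φ : V → C) (L : Set V) : Prop :=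
  ∀ S ⊆ L, S.Nonempty → G.ConnOn S →
    (p : ℕ∞) < (φ '' S).encard ∨ ∃ v ∈ S, ∀ w ∈ S, φ w = φ v → w = v

lemma CenteredOn.isCenteredColoring {C : Type*} {p : ℕ} {φ : V → C}
    (h : G.CenteredOn p φ Set.univ) : G.IsCenteredColoring p φ := by
  intro H hH
  refine (h H.verts (Set.subset_univ _) hH.nonempty hH.connOn).imp id ?_
  rintro ⟨v, hv, hu⟩
  exact ⟨φ v, v, ⟨hv, rfl⟩, fun w hw => hu w hw.1 hw.2⟩

lemma IsCenteredColoring.centeredOn {C : Type*} {p : ℕ} {φ : V → C} (L : Set V)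
    (h : G.IsCenteredColoring p φ) : G.CenteredOn p φ L := by
  intro S _ hne hS
  obtain ⟨H, hH, rfl⟩ := hS.exists_subgraph hne
  refine (h H hH).imp id ?_
  rintro ⟨c, v, ⟨hv, rfl⟩, hu⟩
  exact ⟨v, hv, fun w hw hwc => hu w ⟨hw, hwc⟩⟩

lemma CenteredOn.of_le {C : Type*} {p : ℕ} {φ : V → C} {L : Set V} {G' : SimpleGraph V}
    (hle : G ≤ G') (h : G'.CenteredOn p φ L) : G.CenteredOn p φ L :=
  fun S hS hne hc => h S hS hne (hc.mono hle)

lemma CenteredOn.comp_injective {C D : Type*} {p : ℕ} {φ : V → C} {L : Set V} {g : C → D}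
    (hg : Function.Injective g) (h : G.CenteredOn p φ L) : G.CenteredOn p (g ∘ φ) L := by
  intro S hS hne hc
  refine (h S hS hne hc).imp (fun h => ?_) ?_
  · rwa [Set.image_comp, hg.encard_image]
  · rintro ⟨v, hv, hu⟩
    exact ⟨v, hv, fun w hw hwv => hu w hw (hg hwv)⟩

lemma CenteredOn.exists_fin {C : Type*} [Fintype C] {p : ℕ} {φ : V → C} {L : Set V}
    (h : G.CenteredOn p φ L) : ∃ ψ : V → Fin (Fintype.card C), G.CenteredOn p ψ L :=
  ⟨_, h.comp_injective (Fintype.equivFin C).injective⟩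

lemma lt_encard_image_of_distinct {C : Type*} {p : ℕ} {φ : V → C} {S : Set V} (x : ℕ → V)
    (hx : ∀ j ≤ p, x j ∈ S) (hd : ∀ j j', j < j' → j' ≤ p → φ (x j) ≠ φ (x j')) :
    (p : ℕ∞) < (φ '' S).encard := by
  have hinj : Set.InjOn (fun j => φ (x j)) (Set.Iic p) := by
    intro a ha b hb hab
    rcases lt_trichotomy a b with h | h | h
    · exact absurd hab (hd a b h hb)
    · exact h
    · exact absurd hab.symm (hd b a h ha)
  have h1 : ((fun j => φ (x j)) '' Set.Iic p).encard = (p + 1 : ℕ) := by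
    rw [hinj.encard_image, ← Finset.coe_Iic, Set.encard_coe_eq_coe_finsetCard]
    simp
  have h2 : ((fun j => φ (x j)) '' Set.Iic p) ⊆ φ '' S := by
    rintro _ ⟨j, hj, rfl⟩
    exact ⟨x j, hx j hj, rfl⟩
  refine lt_of_lt_of_le ?_ (Set.encard_le_encard h2)
  rw [h1]
  exact_mod_cast Nat.lt_succ_self p

end SimpleGraph

/-! ### Layerings of chordal graphs and the reduction to the layers -/

namespace SimpleGraph

variable {V : Type*} [LinearOrder V] {G : SimpleGraph V}

/-- The linear order is a perfect elimination ordering: the smaller neighbours of every vertex form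
a clique. -/
def IsElimOrdered (G : SimpleGraph V) : Prop :=
  ∀ u v w : V, u < w → v < w → u ≠ v → G.Adj u w → G.Adj v w → G.Adj u v

/-- Cliques in `L` have at most `k + 1` vertices and cliques of size `k` in `L` have at most two
common neighbours in `L`. -/
structure SimpleOn (G : SimpleGraph V) (k : ℕ) (L : Set V) : Prop where
  clique_le : ∀ s : Finset V, (s : Set V) ⊆ L → G.IsClique s → s.card ≤ k + 1
  common_le : ∀ X : Finset V, (X : Set V) ⊆ L → G.IsClique (X : Set V) → X.card = k →
    ∀ a ∈ L, ∀ b ∈ L, ∀ c ∈ L, (∀ x ∈ X, G.Adj a x) → (∀ x ∈ X, G.Adj b x) →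
      (∀ x ∈ X, G.Adj c x) → a = b ∨ a = c ∨ b = c

/-- A layering of `L`, as given by the distance to the smallest vertex of every component. -/
structure IsLayering (G : SimpleGraph V) (L : Set V) (ℓ : V → ℕ) : Prop where
  mono : ∀ u ∈ L, ∀ v ∈ L, u < v → G.Adj u v → ℓ u ≤ ℓ v ∧ ℓ v ≤ ℓ u + 1
  exists_below : ∀ v ∈ L, ℓ v ≠ 0 → ∃ u ∈ L, u < v ∧ G.Adj u v ∧ ℓ v = ℓ u + 1
  of_eq_zero : ∀ v ∈ L, ℓ v = 0 → ∀ u ∈ L, u < v → ¬ G.Adj u v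

/-- The layer of `v` is one more than the least layer of its smaller neighbours, and `0` if there
are none. Monotonicity follows by induction: a smaller neighbour `u` and the minimising one `w` are
equal or adjacent by the elimination property. -/
lemma exists_isLayering [Finite V] (hG : G.IsElimOrdered) (L : Set V) :
    ∃ ℓ : V → ℕ, G.IsLayering L ℓ := by
  have wf : WellFounded ((· < ·) : V → V → Prop) := wellFounded_lt
  let F : (v : V) → ((u : V) → u < v → ℕ) → ℕ :=
    fun v ih => sInf {n | ∃ u, ∃ h : u < v, u ∈ L ∧ G.Adj u v ∧ n = ih u h + 1}
  let ℓ : V → ℕ := wf.fix F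
  have hℓ : ∀ v, ℓ v = sInf {n | ∃ u, ∃ _ : u < v, u ∈ L ∧ G.Adj u v ∧ n = ℓ u + 1} :=
    fun v => wf.fix_eq F v
  have hle : ∀ u ∈ L, ∀ v, u < v → G.Adj u v → ℓ v ≤ ℓ u + 1 := by
    intro u hu v huv ha
    rw [hℓ v]
    exact Nat.sInf_le ⟨u, huv, hu, ha, rfl⟩
  have hex : ∀ u ∈ L, ∀ v, u < v → G.Adj u v → ∃ w ∈ L, w < v ∧ G.Adj w v ∧ ℓ v = ℓ w + 1 := by
    intro u hu v huv ha
    obtain ⟨w, h1, h2, h3, h4⟩ :=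
      Nat.sInf_mem (s := {n | ∃ u, ∃ _ : u < v, u ∈ L ∧ G.Adj u v ∧ n = ℓ u + 1})
        ⟨_, u, huv, hu, ha, rfl⟩
    exact ⟨w, h2, h1, h3, (hℓ v).trans h4⟩
  have hmono : ∀ v ∈ L, ∀ u ∈ L, u < v → G.Adj u v → ℓ u ≤ ℓ v := by
    intro v
    induction v using wf.induction with
    | _ v ih =>
      intro hv u hu huv ha
      obtain ⟨w, hw, hwv, hwa, he⟩ := hex u hu v huv ha
      rcases lt_trichotomy u w with h | h | h
      · have := ih w hwv hw u hu h (hG u w v huv hwv h.ne ha hwa)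
        omega
      · subst h; omega
      · have := hle w hw u h (hG w u v hwv huv h.ne hwa ha)
        omega
  refine ⟨ℓ, fun u hu v hv huv ha => ⟨hmono v hv u hu huv ha, hle u hu v huv ha⟩, ?_, ?_⟩
  · intro v hv h0
    by_contra! hno
    apply h0
    rw [hℓ v]
    have : {n | ∃ u, ∃ _ : u < v, u ∈ L ∧ G.Adj u v ∧ n = ℓ u + 1} = ∅ := by
      rw [Set.eq_empty_iff_forall_notMem]
      rintro n ⟨u, huv, hu, ha, -⟩
      obtain ⟨w, h1, h2, h3, h4⟩ := hex u hu v huv ha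
      exact hno w h1 h2 h3 h4
    rw [this, Nat.sInf_empty]
  · intro v hv h0 u hu huv ha
    obtain ⟨w, h1, h2, h3, h4⟩ := hex u hu v huv ha
    omega

namespace IsLayering

variable {L : Set V} {ℓ : V → ℕ}

lemma lt_of_layer_lt (h : G.IsLayering L ℓ) {u v : V} (hu : u ∈ L) (hv : v ∈ L)
    (ha : G.Adj u v) (hl : ℓ u < ℓ v) : u < v := by
  rcases lt_trichotomy u v with h1 | h1 | h1
  · exact h1
  · exact absurd h1 ha.ne
  · have := (h.mono v hv u hu h1 ha.symm).1
    omega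

lemma le_succ (h : G.IsLayering L ℓ) {u v : V} (hu : u ∈ L) (hv : v ∈ L)
    (ha : G.Adj u v) : ℓ v ≤ ℓ u + 1 := by
  rcases lt_trichotomy u v with h1 | h1 | h1
  · exact (h.mono u hu v hv h1 ha).2
  · exact absurd h1 ha.ne
  · have := (h.mono v hv u hu h1 ha.symm).1
    omega

/-- Every non-empty clique in a positive layer has a common neighbour in the layer below. -/
lemma exists_common_below (hG : G.IsElimOrdered) (h : G.IsLayering L ℓ) {i : ℕ}
    {s : Finset V} (hs : ∀ x ∈ s, x ∈ L ∧ ℓ x = i + 1) (hc : G.IsClique (s : Set V))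
    (hne : s.Nonempty) : ∃ y ∈ L, ℓ y = i ∧ ∀ x ∈ s, G.Adj y x := by
  obtain ⟨hwL, hwi⟩ := hs _ (s.max'_mem hne)
  -- A lower neighbour of the largest clique vertex works: it and the remaining clique vertices are
  -- smaller neighbours of that vertex, so the ordering makes them adjacent.
  obtain ⟨y, hy, hyw, hya, he⟩ := h.exists_below _ hwL (by omega)
  refine ⟨y, hy, by omega, fun x hx => ?_⟩
  by_cases hxw : x = s.max' hne
  · rw [hxw]; exact hya
  · have hlt : x < s.max' hne := lt_of_le_of_ne (s.le_max' x hx) hxw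
    refine hG y x _ hyw hlt ?_ hya (hc hx (s.max'_mem hne) hxw)
    rintro rfl
    have := (hs _ hx).2
    omega

/-- The part of a connected set in its lowest layer is connected. -/
lemma connOn_lowest [Finite V] (hG : G.IsElimOrdered) (h : G.IsLayering L ℓ) {i : ℕ} (s : Finset V)
    (hsL : (s : Set V) ⊆ L) (hs : G.ConnOn (s : Set V)) (hi : ∀ x ∈ s, i ≤ ℓ x) :
    G.ConnOn {x | x ∈ s ∧ ℓ x = i} := by
  induction hn : s.card generalizing s with
  | zero =>
    rw [Finset.card_eq_zero] at hn
    subst hn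
    rintro A - - ⟨b, hb, -⟩
    exact absurd hb.1 (Finset.notMem_empty _)
  | succ n ih =>
    by_cases hall : ∀ x ∈ s, ℓ x = i
    · convert hs using 1
      ext x
      simpa using hall x
    push Not at hall
    obtain ⟨x₀, hx₀, hne⟩ := hall
    -- The largest vertex of the top layer is removed. All its neighbours in `s` precede it and thus
    -- form a clique, so `s` stays connected.
    obtain ⟨m, hm, hmax⟩ := s.exists_max_image ℓ ⟨x₀, hx₀⟩
    obtain ⟨v, hv, hvmax⟩ := (s.filter (fun x => ℓ x = ℓ m)).exists_max_image id
      ⟨m, by simp [hm]⟩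
    rw [Finset.mem_filter] at hv
    have hvi : ℓ v ≠ i := by
      have h1 := hmax x₀ hx₀
      have h2 := hi x₀ hx₀
      omega
    have hback : ∀ a ∈ s, G.Adj a v → a < v := by
      intro a ha hav
      rcases (hmax a ha).lt_or_eq with h1 | h1
      · exact h.lt_of_layer_lt (hsL ha) (hsL hv.1) hav (by omega)
      · exact lt_of_le_of_ne (hvmax a (by simp [ha, h1])) hav.ne
    have hconn : G.ConnOn ((s.erase v : Finset V) : Set V) := by
      rw [Finset.coe_erase]
      exact hs.diff_simplicial fun a ha b hb hab h1 h2 =>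
        hG a b v (hback a ha h1) (hback b hb h2) hab h1 h2
    have := ih (s.erase v) (fun x hx => hsL (Finset.mem_of_mem_erase hx)) hconn
      (fun x hx => hi x (Finset.mem_of_mem_erase hx)) (by rw [Finset.card_erase_of_mem hv.1]; omega)
    convert this using 1
    ext x
    simp only [Set.mem_ofPred_eq, Finset.mem_erase]
    constructor
    · rintro ⟨h1, h2⟩
      exact ⟨⟨fun e => hvi (e ▸ h2), h1⟩, h2⟩
    · rintro ⟨⟨_, h1⟩, h2⟩
      exact ⟨h1, h2⟩

/-- The layers of a `(k + 1)`-simple chordal graph are `k`-simple. -/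
lemma simpleOn_layer (hG : G.IsElimOrdered) (h : G.IsLayering L ℓ) {k : ℕ} (hk : 1 ≤ k)
    (hL : G.SimpleOn (k + 1) L) (i : ℕ) : G.SimpleOn k {x | x ∈ L ∧ ℓ x = i} := by
  classical
  rcases i with _ | i
  · have hnadj : ∀ x y : V, (x ∈ L ∧ ℓ x = 0) → (y ∈ L ∧ ℓ y = 0) → ¬ G.Adj x y := by
      rintro x y ⟨hx, hx0⟩ ⟨hy, hy0⟩ ha
      rcases lt_trichotomy x y with h1 | h1 | h1
      · exact h.of_eq_zero y hy hy0 x hx h1 ha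
      · exact ha.ne h1
      · exact h.of_eq_zero x hx hx0 y hy h1 ha.symm
    constructor
    · intro s hs hc
      by_contra! hcard
      obtain ⟨a, ha, b, hb, hab⟩ := Finset.one_lt_card.1 (by omega : 1 < s.card)
      exact hnadj a b (hs ha) (hs hb) (hc ha hb hab)
    · intro X hX _ hcard a ha b hb c hc h1 h2 h3
      obtain ⟨x, hx⟩ := Finset.card_pos.1 (by omega : 0 < X.card)
      exact absurd (h1 x hx) (hnadj a x ha (hX hx))
  have hins : ∀ (s : Finset V) (y : V), G.IsClique (s : Set V) → (∀ x ∈ s, G.Adj y x) →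
      G.IsClique ((insert y s : Finset V) : Set V) := by
    intro s y hs hy
    rw [Finset.coe_insert, isClique_insert]
    exact ⟨hs, fun x hx _ => hy x hx⟩
  have hcardins : ∀ (s : Finset V) (y : V), (∀ x ∈ s, G.Adj y x) →
      (insert y s).card = s.card + 1 :=
    fun s y hy => Finset.card_insert_of_notMem fun hys => (hy y hys).ne rfl
  constructor
  · intro s hs hc
    rcases s.eq_empty_or_nonempty with rfl | hne
    · simp
    obtain ⟨y, hy, -, hya⟩ := h.exists_common_below hG (i := i) (fun x hx => hs hx) hc hne
    have := hL.clique_le (insert y s)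
      (by rw [Finset.coe_insert]; exact Set.insert_subset hy fun x hx => (hs hx).1)
      (hins s y hc hya)
    rw [hcardins s y hya] at this
    omega
  · intro X hX hXc hcard a ha b hb c hc h1 h2 h3
    by_contra! hne
    obtain ⟨hab, hac, hbc⟩ := hne
    have hbelow : ∀ a, (a ∈ L ∧ ℓ a = i + 1) → (∀ x ∈ X, G.Adj a x) →
        ∃ y ∈ L, ℓ y = i ∧ G.Adj y a ∧ ∀ x ∈ X, G.Adj y x := by
      intro a ha hax
      obtain ⟨y, hy, hyi, hya⟩ := h.exists_common_below hG (i := i) (s := insert a X)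
        (by
          intro x hx
          rcases Finset.mem_insert.1 hx with rfl | hx
          · exact ha
          · exact hX hx) (hins X a hXc hax) ⟨a, by simp⟩
      exact ⟨y, hy, hyi, hya a (by simp), fun x hx => hya x (by simp [hx])⟩
    obtain ⟨ya, hya, hyai, hyaa, hyax⟩ := hbelow a ha h1
    obtain ⟨yb, hyb, hybi, hybb, hybx⟩ := hbelow b hb h2
    obtain ⟨yc, hyc, hyci, hycc, hycx⟩ := hbelow c hc h3
    obtain ⟨x₀, hx₀⟩ := Finset.card_pos.1 (by omega : 0 < X.card)
    have hlow : ∀ y y', y ∈ L → y' ∈ L → ℓ y = i → ℓ y' = i → (∀ x ∈ X, G.Adj y x) →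
        (∀ x ∈ X, G.Adj y' x) → y ≠ y' → G.Adj y y' := by
      intro y y' hy hy' hyi hyi' h h' hne
      have hx := hX hx₀
      exact hG y y' x₀
        (IsLayering.lt_of_layer_lt ‹_› hy hx.1 (h x₀ hx₀) (by have := hx.2; omega))
        (IsLayering.lt_of_layer_lt ‹_› hy' hx.1 (h' x₀ hx₀) (by have := hx.2; omega)) hne
        (h x₀ hx₀) (h' x₀ hx₀)
    -- two of the three vertices with the same lower neighbour `y`, and a second lower vertex
    have three : ∀ y ∈ L, ∀ u ∈ L, ∀ v ∈ L, ∀ w ∈ L, (∀ x ∈ X, G.Adj y x) → (∀ x ∈ X, G.Adj u x) →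
        (∀ x ∈ X, G.Adj v x) → (∀ x ∈ X, G.Adj w x) → G.Adj y u → G.Adj y v → G.Adj y w →
        u ≠ v → u ≠ w → v ≠ w → False := by
      intro y hy u hu v hv w hw hyx hux hvx hwx hyu hyv hyw huv huw hvw
      have hadj : ∀ u, G.Adj y u → (∀ x ∈ X, G.Adj u x) → ∀ x ∈ insert y X, G.Adj u x := by
        intro u hyu hux x hx
        rcases Finset.mem_insert.1 hx with rfl | hx
        · exact hyu.symm
        · exact hux x hx
      have := hL.common_le (insert y X)
        (by rw [Finset.coe_insert]; exact Set.insert_subset hy fun x hx => (hX hx).1)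
        (hins X y hXc hyx) (by rw [hcardins X y hyx, hcard]) u hu v hv w hw
        (hadj u hyu hux) (hadj v hyv hvx) (hadj w hyw hwx)
      tauto
    have hlne : ∀ u y : V, ℓ u = i + 1 → ℓ y = i → u ≠ y := by
      rintro u y hu hy rfl
      omega
    have two : ∀ y ∈ L, ∀ y' ∈ L, ℓ y = i → ℓ y' = i → y ≠ y' → (∀ x ∈ X, G.Adj y x) →
        (∀ x ∈ X, G.Adj y' x) → ∀ u, ∀ v, (u ∈ L ∧ ℓ u = i + 1) → (v ∈ L ∧ ℓ v = i + 1) → u ≠ v →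
        (∀ x ∈ X, G.Adj u x) → (∀ x ∈ X, G.Adj v x) → G.Adj y u → G.Adj y v → False := by
      intro y hy y' hy' hyi hyi' hyy' hyx hyx' u v hu hv huv hux hvx hyu hyv
      exact three y hy u hu.1 v hv.1 y' hy' hyx hux hvx hyx' hyu hyv
        (hlow y y' hy hy' hyi hyi' hyx hyx' hyy') huv (hlne u y' hu.2 hyi') (hlne v y' hv.2 hyi')
    -- there are at most two common lower neighbours of `X`
    have hyy : ∀ y ∈ L, ∀ y' ∈ L, ∀ y'' ∈ L, ℓ y = i → ℓ y' = i → ℓ y'' = i →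
        (∀ x ∈ X, G.Adj y x) → (∀ x ∈ X, G.Adj y' x) → (∀ x ∈ X, G.Adj y'' x) →
        y ≠ y' → y ≠ y'' → y' ≠ y'' → False := by
      intro y hy y' hy' y'' hy'' hi hi' hi'' hx hx' hx'' n1 n2 n3
      have hc1 := hins X y'' hXc hx''
      have hc2 := hins (insert y'' X) y' hc1 (by
        intro x hxm
        rcases Finset.mem_insert.1 hxm with rfl | hxm
        · exact hlow y' x hy' hy'' hi' hi'' hx' hx'' n3
        · exact hx' x hxm)
      have hadj : ∀ x ∈ insert y' (insert y'' X), G.Adj y x := by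
        intro x hxm
        rcases Finset.mem_insert.1 hxm with rfl | hxm
        · exact hlow y x hy hy' hi hi' hx hx' n1
        rcases Finset.mem_insert.1 hxm with rfl | hxm
        · exact hlow y x hy hy'' hi hi'' hx hx'' n2
        · exact hx x hxm
      have hc3 := hins _ y hc2 hadj
      have hle := hL.clique_le _ (by
        simp only [Finset.coe_insert]
        exact Set.insert_subset hy (Set.insert_subset hy' (Set.insert_subset hy''
          fun x hx => (hX hx).1))) hc3
      rw [hcardins _ y hadj, Finset.card_insert_of_notMem, hcardins X y'' hx'', hcard] at hle
      · omega
      · intro hm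
        rcases Finset.mem_insert.1 hm with hm | hm
        · exact n3 hm
        · exact (hx' y' hm).ne rfl
    -- If the three lower vertices coincide, `X` with that vertex has the common neighbours `a`,
    -- `b`, `c`. If exactly two coincide, the other lower vertex serves as third common neighbour.
    -- If they are distinct, they form with `X` a clique of size `k + 3`.
    by_cases e1 : ya = yb
    · subst e1
      by_cases e2 : ya = yc
      · subst e2
        exact three ya hya a ha.1 b hb.1 c hc.1 hyax h1 h2 h3 hyaa hybb hycc hab hac hbc
      · exact two ya hya yc hyc hyai hyci e2 hyax hycx a b ha hb hab h1 h2 hyaa hybb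
    by_cases e2 : ya = yc
    · subst e2
      exact two ya hya yb hyb hyai hybi e1 hyax hybx a c ha hc hac h1 h3 hyaa hycc
    by_cases e3 : yb = yc
    · subst e3
      exact two yb hyb ya hya hybi hyai (Ne.symm e1) hybx hyax b c hb hc hbc h2 h3 hybb hycc
    exact hyy ya hya yb hyb yc hyc hyai hybi hyci hyax hybx hycx e1 e2 e3

end IsLayering

/-- Passing from the layers to the whole graph multiplies the number of colours by `p + 1`. -/
lemma exists_centeredOn_of_layers [Finite V] (hG : G.IsElimOrdered) {L : Set V} {ℓ : V → ℕ}
    (h : G.IsLayering L ℓ) {p N : ℕ}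
    (hlay : ∀ i, ∃ φ : V → Fin N, G.CenteredOn p φ {x | x ∈ L ∧ ℓ x = i}) :
    ∃ φ : V → Fin ((p + 1) * N), G.CenteredOn p φ L := by
  classical
  choose φ hφ using hlay
  let ψ : V → Fin (p + 1) × Fin N := fun v => (Fin.ofNat (p + 1) (ℓ v), φ (ℓ v) v)
  suffices hψ : G.CenteredOn p ψ L by
    have := hψ.comp_injective finProdFinEquiv.injective
    exact ⟨_, this⟩
  intro S hS hne hconn
  obtain ⟨m, hm, hmin⟩ := Set.exists_min_image S ℓ (Set.toFinite S) hne
  have hmod : ∀ x y : V, ψ x = ψ y → ℓ x % (p + 1) = ℓ y % (p + 1) := by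
    intro x y hxy
    have := congrArg (fun c => (c.1 : Fin (p + 1)).val) hxy
    simpa [ψ, Fin.ofNat] using this
  -- Reaching layer `ℓ m + p` exhibits all `p + 1` residues, hence more than `p` colours. Otherwise
  -- the residue of `ℓ m` identifies the lowest layer within `S`.
  by_cases hhigh : ∃ w ∈ S, ℓ m + p ≤ ℓ w
  · left
    obtain ⟨w, hw, hwp⟩ := hhigh
    have hlev : ∀ j ≤ p, ∃ x ∈ S, ℓ x = ℓ m + j := by
      intro j hj
      rcases Nat.eq_zero_or_pos j with rfl | hj0
      · exact ⟨m, hm, rfl⟩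
      obtain ⟨a, ha, b, hb, hfa, hfb, hab⟩ := hconn.exists_crossing (f := fun x => ℓ x < ℓ m + j)
        ⟨m, hm, by omega⟩ ⟨w, hw, by omega⟩
      have := h.le_succ (hS ha) (hS hb) hab
      exact ⟨b, hb, by omega⟩
    have : Nonempty V := ⟨m⟩
    choose! x hxS hxl using hlev
    refine lt_encard_image_of_distinct x hxS ?_
    intro j j' hjj hj' he
    have := hmod _ _ he
    rw [hxl j (by omega), hxl j' hj'] at this
    have h3 : (ℓ m + j) ≡ (ℓ m + j') [MOD (p + 1)] := this
    have h4 := Nat.ModEq.add_left_cancel' _ h3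
    have := Nat.ModEq.eq_of_lt_of_lt h4 (by omega) (by omega)
    omega
  push Not at hhigh
  have hlow : G.ConnOn {x | x ∈ S ∧ ℓ x = ℓ m} := by
    have := h.connOn_lowest hG (i := ℓ m) (Set.toFinite S).toFinset (by simpa using hS)
      (by simpa using hconn) (by simpa using hmin)
    simpa using this
  rcases hφ (ℓ m) {x | x ∈ S ∧ ℓ x = ℓ m} (fun x hx => ⟨hS hx.1, hx.2⟩) ⟨m, hm, rfl⟩ hlow with
    h1 | ⟨v, ⟨hv, hvl⟩, hu⟩
  · left
    refine lt_of_lt_of_le h1 ?_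
    have himg : φ (ℓ m) '' {x | x ∈ S ∧ ℓ x = ℓ m} ⊆ Prod.snd '' (ψ '' S) := by
      rintro _ ⟨x, ⟨hx, hxl⟩, rfl⟩
      exact ⟨ψ x, ⟨x, hx, rfl⟩, by simp [ψ, hxl]⟩
    exact (Set.encard_le_encard himg).trans (Set.encard_image_le _ _)
  · right
    refine ⟨v, hv, fun w hw hwv => ?_⟩
    have h2 := hmod _ _ hwv
    have h3 := hmin w hw
    have h4 := hhigh w hw
    obtain ⟨d, hd⟩ := Nat.exists_eq_add_of_le h3
    rw [hvl, hd] at h2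
    have h5 : ℓ m + d ≡ ℓ m + 0 [MOD (p + 1)] := h2
    have h6 := Nat.ModEq.eq_of_lt_of_lt (Nat.ModEq.add_left_cancel' _ h5) (by omega) (by omega)
    subst h6
    refine hu w ⟨hw, by simpa using hd⟩ ?_
    have := congrArg Prod.snd hwv
    simpa [ψ, hvl, hd] using this

end SimpleGraph

/-! ### Ruler sequences and greedy colourings -/

/-- The ruler colouring: every integer interval of length at most `2 ^ R` has a point whose colour
is unique in the interval. -/
lemma exists_ruler (R : ℕ) : ∃ ρ : ℤ → Fin (R + 1), ∀ a b : ℤ, a ≤ b → b - a < 2 ^ R →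
    ∃ j, a ≤ j ∧ j ≤ b ∧ ∀ j', a ≤ j' → j' ≤ b → ρ j' = ρ j → j' = j := by
  induction R with
  | zero =>
    refine ⟨fun _ => 0, fun a b hab h => ⟨a, le_refl _, hab, fun j' h1 h2 _ => ?_⟩⟩
    norm_num at h
    omega
  | succ R ih =>
    obtain ⟨ρ, hρ⟩ := ih
    -- Odd integers share one colour and even ones are coloured recursively through their halves. An
    -- interval without even integers is a single point.
    refine ⟨fun j => if j % 2 = 0 then (ρ (j / 2)).succ else 0, fun a b hab h => ?_⟩
    rw [pow_succ] at h
    by_cases he : (a + 1) / 2 ≤ b / 2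
    · obtain ⟨j, h1, h2, h3⟩ := hρ ((a + 1) / 2) (b / 2) he (by omega)
      refine ⟨2 * j, by omega, by omega, fun j' h4 h5 h6 => ?_⟩
      have e1 : 2 * j % 2 = 0 := by omega
      have e2 : 2 * j / 2 = j := by omega
      by_cases hj : j' % 2 = 0
      · simp only [hj, e1, e2, if_true] at h6
        have := h3 (j' / 2) (by omega) (by omega) (Fin.succ_injective _ h6)
        omega
      · simp only [hj, e1, if_true, if_false] at h6
        exact absurd h6.symm (Fin.succ_ne_zero _)
    · exact ⟨a, le_refl _, hab, fun j' h4 h5 _ => by omega⟩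

/-- Greedy colouring along a rank function. -/
lemma exists_greedy_coloring {V : Type*} [Finite V] (r : V → ℕ) (conf : V → V → Prop) (D : ℕ)
    (hD : ∀ v, {u | r u < r v ∧ conf u v}.ncard ≤ D) :
    ∃ g : V → Fin (D + 1), ∀ u v, r u < r v → conf u v → g u ≠ g v := by
  classical
  have key : ∀ n : ℕ, ∃ g : V → Fin (D + 1), ∀ u v, r v < n → r u < r v → conf u v → g u ≠ g v := by
    intro n
    induction n with
    | zero => exact ⟨fun _ => 0, fun u v h => absurd h (by omega)⟩
    | succ n ih =>
      obtain ⟨g, hg⟩ := ih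
      have hfree : ∀ v, ∃ c : Fin (D + 1), ∀ u, r u < r v → conf u v → g u ≠ c := by
        intro v
        by_contra! hno
        have hsub : (Set.univ : Set (Fin (D + 1))) ⊆ g '' {u | r u < r v ∧ conf u v} := by
          intro c _
          obtain ⟨u, h1, h2, h3⟩ := hno c
          exact ⟨u, ⟨h1, h2⟩, h3⟩
        have h1 := Set.ncard_le_ncard hsub
        rw [Set.ncard_univ, Nat.card_fin] at h1
        have h2 := Set.ncard_image_le (f := g) (Set.toFinite {u | r u < r v ∧ conf u v})
        have := hD v
        omega
      choose c hc using hfree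
      refine ⟨fun v => if r v = n then c v else g v, fun u v hv huv huc => ?_⟩
      have hun : r u ≠ n := by omega
      by_cases hvn : r v = n
      · simp only [hvn, hun, if_true, if_false]
        exact hc v u huv huc
      · simp only [hvn, hun, if_false]
        exact hg u v (by omega) huv huc
  obtain ⟨B, hB⟩ := (Set.finite_range r).bddAbove
  obtain ⟨g, hg⟩ := key (B + 1)
  exact ⟨g, fun u v h1 h2 => hg u v (Nat.lt_succ_of_le (hB ⟨v, rfl⟩)) h1 h2⟩

/-! ### Integer positions on linear forests -/

namespace SimpleGraph

variable {V : Type*} {G : SimpleGraph V}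

/-- An integer position function on a linear forest: adjacent vertices have consecutive positions
and different neighbours of a vertex have different positions. -/
structure IsPosition (G : SimpleGraph V) (L : Set V) (f : V → ℤ) : Prop where
  adj : ∀ u ∈ L, ∀ v ∈ L, G.Adj u v → f u = f v + 1 ∨ f v = f u + 1
  locally_injective : ∀ u ∈ L, ∀ v ∈ L, ∀ w ∈ L, G.Adj u w → G.Adj v w → f u = f v → u = v

lemma SimpleOn.back_unique [LinearOrder V] (hG : G.IsElimOrdered) {L : Set V} (hL : G.SimpleOn 1 L)
    {u v w : V} (hu : u ∈ L) (hv : v ∈ L) (hw : w ∈ L) (huw : u < w) (hvw : v < w)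
    (h1 : G.Adj u w) (h2 : G.Adj v w) : u = v := by
  classical
  by_contra hne
  have hadj := hG u v w huw hvw hne h1 h2
  have h3 := hL.clique_le {u, v, w} (by
      intro x hx
      simp only [Finset.coe_insert, Finset.coe_singleton, Set.mem_insert_iff,
        Set.mem_singleton_iff] at hx
      rcases hx with rfl | rfl | rfl <;> assumption)
    (by
      simp only [Finset.coe_insert, Finset.coe_singleton]
      rw [isClique_insert, isClique_insert]
      simp [hadj, h1, h2])
  rw [Finset.card_insert_of_notMem (by simp [hne, huw.ne]),
    Finset.card_insert_of_notMem (by simp [hvw.ne]), Finset.card_singleton] at h3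
  omega

lemma SimpleOn.neighbors_le {L : Set V} (hL : G.SimpleOn 1 L) {a b c x : V} (hx : x ∈ L)
    (ha : a ∈ L) (hb : b ∈ L) (hc : c ∈ L) (h1 : G.Adj a x) (h2 : G.Adj b x) (h3 : G.Adj c x) :
    a = b ∨ a = c ∨ b = c :=
  hL.common_le {x} (by simpa using hx) (by simp) (by simp) a ha b hb c hc (by simpa using h1)
    (by simpa using h2) (by simpa using h3)

/-- Vertices are placed in increasing order. A new vertex has at most one earlier neighbour `u`, and
`u` has at most one neighbour already placed, so one side of `u` is free. -/
lemma exists_isPosition [LinearOrder V] [Finite V] (hG : G.IsElimOrdered) {L : Set V} (hL : G.SimpleOn 1 L) :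
    ∃ f : V → ℤ, G.IsPosition L f := by
  classical
  suffices h : ∀ s : Finset V, (s : Set V) ⊆ L → ∃ f : V → ℤ, G.IsPosition (s : Set V) f by
    simpa using h (Set.toFinite L).toFinset (by simp)
  intro s
  induction s using Finset.induction_on_max with
  | empty => exact fun _ => ⟨fun _ => 0, by constructor <;> simp⟩
  | insert a s hmax ih =>
    intro hs
    rw [Finset.coe_insert, Set.insert_subset_iff] at hs
    obtain ⟨haL, hsL⟩ := hs
    obtain ⟨f, hf⟩ := ih hsL
    have has : a ∉ s := fun h => lt_irrefl _ (hmax a h)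
    have hnea : ∀ x ∈ s, x ≠ a := fun x hx e => has (e ▸ hx)
    by_cases hback : ∃ u ∈ s, G.Adj u a
    · obtain ⟨u, hu, hua⟩ := hback
      have huniq : ∀ x ∈ s, G.Adj x a → x = u := fun x hx hxa =>
        hL.back_unique hG (hsL hx) (hsL hu) haL (hmax x hx) (hmax u hu) hxa hua
      obtain ⟨t, ht1, ht2⟩ : ∃ t : ℤ, (t = f u + 1 ∨ f u = t + 1) ∧
          ∀ x ∈ s, G.Adj x u → f x ≠ t := by
        by_cases hx : ∃ x ∈ s, G.Adj x u
        · obtain ⟨x, hx, hxu⟩ := hx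
          -- The mirror image of the position of `x` at `u`.
          refine ⟨2 * f u - f x, ?_, ?_⟩
          · rcases hf.adj x hx u hu hxu with h | h <;> omega
          · intro y hy hyu
            have hyx : y = x := by
              rcases hL.neighbors_le (hsL hu) haL (hsL hx) (hsL hy) hua.symm hxu hyu with h | h | h
              · exact absurd h.symm (hnea x hx)
              · exact absurd h.symm (hnea y hy)
              · exact h.symm
            subst hyx
            rcases hf.adj y hy u hu hyu with h | h <;> omega
        · push Not at hx
          exact ⟨f u + 1, Or.inl rfl, fun x hxs hxu => absurd hxu (hx x hxs)⟩
      have hfa : Function.update f a t a = t := Function.update_self ..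
      have hfx : ∀ x ∈ s, Function.update f a t x = f x :=
        fun x hx => Function.update_of_ne (hnea x hx) _ _
      refine ⟨Function.update f a t, ?_, ?_⟩
      · intro x hx y hy hxy
        rw [Finset.coe_insert, Set.mem_insert_iff] at hx hy
        rcases hx with rfl | hx <;> rcases hy with rfl | hy
        · exact absurd rfl hxy.ne
        · rw [hfa, hfx y hy, huniq y hy hxy.symm]; exact ht1
        · rw [hfa, hfx x hx, huniq x hx hxy]; exact ht1.symm
        · rw [hfx x hx, hfx y hy]; exact hf.adj x hx y hy hxy
      · intro x hx y hy w hw hxw hyw he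
        rw [Finset.coe_insert, Set.mem_insert_iff] at hx hy hw
        rcases hw with rfl | hw
        · rcases hx with rfl | hx
          · exact absurd rfl hxw.ne
          rcases hy with rfl | hy
          · exact absurd rfl hyw.ne
          rw [huniq x hx hxw, huniq y hy hyw]
        rcases hx with rfl | hx <;> rcases hy with rfl | hy
        · rfl
        · rw [hfa, hfx y hy] at he
          have := huniq w hw hxw.symm
          subst this
          exact absurd he.symm (ht2 y hy hyw)
        · rw [hfa, hfx x hx] at he
          have := huniq w hw hyw.symm
          subst this
          exact absurd he (ht2 x hx hxw)
        · rw [hfx x hx, hfx y hy] at he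
          exact hf.locally_injective x hx y hy w hw hxw hyw he
    · push Not at hback
      refine ⟨f, ?_, ?_⟩
      · intro x hx y hy hxy
        rw [Finset.coe_insert, Set.mem_insert_iff] at hx hy
        rcases hx with rfl | hx <;> rcases hy with rfl | hy
        · exact absurd rfl hxy.ne
        · exact absurd hxy.symm (hback y hy)
        · exact absurd hxy (hback x hx)
        · exact hf.adj x hx y hy hxy
      · intro x hx y hy w hw hxw hyw he
        rw [Finset.coe_insert, Set.mem_insert_iff] at hx hy hw
        rcases hw with rfl | hw
        · rcases hx with rfl | hx
          · exact absurd rfl hxw.ne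
          · exact absurd hxw (hback x hx)
        rcases hx with rfl | hx
        · exact absurd hxw.symm (hback w hw)
        rcases hy with rfl | hy
        · exact absurd hyw.symm (hback w hw)
        exact hf.locally_injective x hx y hy w hw hxw hyw he

namespace IsPosition

variable {L S : Set V} {f : V → ℤ}

/-- An edge crossing from positions at most `f u` to larger ones must join the positions `f u` and
`f u + 1`, and injectivity identifies its ends. -/
lemma adj_of_succ (hf : G.IsPosition L f) (hS : S ⊆ L) (hc : G.ConnOn S) (hinj : Set.InjOn f S)
    {u w : V} (hu : u ∈ S) (hw : w ∈ S) (h : f w = f u + 1) : G.Adj u w := by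
  obtain ⟨a, ha, b, hb, hfa, hfb, hab⟩ := hc.exists_crossing (f := fun x => f x ≤ f u)
    ⟨u, hu, le_refl _⟩ ⟨w, hw, by omega⟩
  have h1 := hf.adj a (hS ha) b (hS hb) hab
  have h2 : a = u := hinj ha hu (by omega)
  have h3 : b = w := hinj hb hw (by omega)
  rw [← h2, ← h3]; exact hab

lemma exists_between (hf : G.IsPosition L f) (hS : S ⊆ L) (hc : G.ConnOn S) {u w : V} (hu : u ∈ S)
    (hw : w ∈ S) {n : ℤ} (h1 : f u ≤ n) (h2 : n ≤ f w) : ∃ x ∈ S, f x = n := by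
  rcases h2.lt_or_eq with h2 | h2
  · obtain ⟨a, ha, b, hb, hfa, hfb, hab⟩ := hc.exists_crossing (f := fun x => f x ≤ n)
      ⟨u, hu, h1⟩ ⟨w, hw, by omega⟩
    have h1 := hf.adj a (hS ha) b (hS hb) hab
    exact ⟨a, ha, by omega⟩
  · exact ⟨w, hw, h2.symm⟩

/-- Removing the largest vertex keeps the set connected. If another vertex `w` had its position,
`adj_of_succ` would make `w` a second neighbour, at the same position, of some neighbour `u` of the
removed vertex, against local injectivity. -/
lemma injOn [LinearOrder V] [Finite V] (hG : G.IsElimOrdered) (hf : G.IsPosition L f) (hS : S ⊆ L)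
    (hc : G.ConnOn S) : Set.InjOn f S := by
  classical
  suffices h : ∀ s : Finset V, (s : Set V) ⊆ L → G.ConnOn (s : Set V) → Set.InjOn f (s : Set V) by
    simpa using h (Set.toFinite S).toFinset (by simpa using hS) (by simpa using hc)
  intro s
  induction s using Finset.induction_on_max with
  | empty => simp
  | insert a s hmax ih =>
    intro hs hc
    have has : a ∉ s := fun h => lt_irrefl _ (hmax a h)
    have haL : a ∈ L := hs (by simp)
    have hsL : (s : Set V) ⊆ L := fun x hx => hs (by simp [Finset.mem_coe.1 hx])
    have hcs : G.ConnOn (s : Set V) := by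
      have := hc.diff_simplicial (x := a) (by
        intro x hx y hy hxy hxa hya
        have hlt : ∀ x ∈ ((insert a s : Finset V) : Set V), G.Adj x a → x < a := by
          intro x hx hxa
          rw [Finset.coe_insert, Set.mem_insert_iff] at hx
          rcases hx with rfl | hx
          · exact absurd rfl hxa.ne
          · exact hmax x hx
        exact hG x y a (hlt x hx hxa) (hlt y hy hya) hxy hxa hya)
      convert this using 1
      rw [Finset.coe_insert]
      exact (Set.insert_sdiff_self_of_notMem (by simpa using has)).symm
    have hinj := ih hsL hcs
    rw [Finset.coe_insert]
    rw [Set.injOn_insert (by simpa using has)]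
    refine ⟨hinj, ?_⟩
    rintro ⟨w, hw, hwa⟩
    obtain ⟨b, hb, u, hu, hba⟩ := hc {a} (by simp) ⟨a, rfl⟩ ⟨w, by
      simp only [Finset.coe_insert, Set.mem_sdiff, Set.mem_insert_iff, Set.mem_singleton_iff]
      exact ⟨Or.inr hw, fun e => has (e ▸ hw)⟩⟩
    rw [Set.mem_singleton_iff] at hb
    subst hb
    have hus : u ∈ s := by
      have h1 := hu.1
      rw [Finset.coe_insert, Set.mem_insert_iff] at h1
      exact h1.resolve_left hu.2
    have hwu : G.Adj w u := by
      rcases hf.adj b haL u (hsL hus) hba with h | h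
      · exact (hf.adj_of_succ hsL hcs hinj hus hw (by omega)).symm
      · exact hf.adj_of_succ hsL hcs hinj hw hus (by omega)
    have := hf.locally_injective w (hsL hw) b haL u (hsL hus) hwu hba hwa
    exact has (this ▸ hw)

end IsPosition

/-- The edges of `G` inside the layers. -/
def sameLayer (G : SimpleGraph V) (ℓ : V → ℕ) : SimpleGraph V where
  Adj u v := G.Adj u v ∧ ℓ u = ℓ v
  symm := ⟨fun _ _ h => ⟨h.1.symm, h.2.symm⟩⟩
  loopless := ⟨fun _ h => h.1.ne rfl⟩

lemma IsElimOrdered.sameLayer [LinearOrder V] (hG : G.IsElimOrdered) (ℓ : V → ℕ) :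
    (G.sameLayer ℓ).IsElimOrdered :=
  fun u v w h1 h2 h3 h4 h5 => ⟨hG u v w h1 h2 h3 h4.1 h5.1, h4.2.trans h5.2.symm⟩

lemma ConnOn.sameLayer {S : Set V} {ℓ : V → ℕ} {i : ℕ} (h : G.ConnOn S) (hi : ∀ x ∈ S, ℓ x = i) :
    (G.sameLayer ℓ).ConnOn S := by
  intro A hA h1 h2
  obtain ⟨a, ha, b, hb, hab⟩ := h A hA h1 h2
  exact ⟨a, ha, b, hb, hab, (hi a (hA ha)).trans (hi b hb.1).symm⟩

/-- A clique of `sameLayer` lies in a single layer, and so do a vertex and its neighbours. This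
makes one position function serve all layers at once. -/
lemma SimpleOn.sameLayer {L : Set V} {ℓ : V → ℕ}
    (hL : ∀ i, G.SimpleOn 1 {x | x ∈ L ∧ ℓ x = i}) : (G.sameLayer ℓ).SimpleOn 1 L := by
  constructor
  · intro s hs hc
    rcases s.eq_empty_or_nonempty with rfl | ⟨x, hx⟩
    · simp
    refine (hL (ℓ x)).clique_le s (fun y hy => ⟨hs hy, ?_⟩)
      (fun y hy z hz hyz => (hc hy hz hyz).1)
    by_cases hxy : y = x
    · rw [hxy]
    · exact (hc hy hx hxy).2
  · intro X hX hXc hcard a ha b hb c hc h1 h2 h3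
    obtain ⟨x, rfl⟩ := Finset.card_eq_one.1 hcard
    simp only [Finset.mem_singleton, forall_eq] at h1 h2 h3
    exact (hL (ℓ x)).neighbors_le ⟨hX (by simp), rfl⟩ ⟨ha, h1.2⟩ ⟨hb, h2.2⟩ ⟨hc, h3.2⟩ h1.1 h2.1 h3.1

end SimpleGraph

/-! ### Ancestors, and the colouring of graphs with linear forests as layers -/

namespace SimpleGraph

variable {V : Type*} {G : SimpleGraph V}

/-- `x` is adjacent to a connected set that contains `w` and lies in the layers above `x`. -/
def IsAncestor (G : SimpleGraph V) (L : Set V) (ℓ : V → ℕ) (x w : V) : Prop :=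
  x ∈ L ∧ ∃ K ⊆ L, G.ConnOn K ∧ w ∈ K ∧ (∀ y ∈ K, ℓ x < ℓ y) ∧ ∃ y ∈ K, G.Adj y x

lemma IsAncestor.lt {L : Set V} {ℓ : V → ℕ} {x w : V} (h : G.IsAncestor L ℓ x w) : ℓ x < ℓ w := by
  obtain ⟨_, K, _, _, hw, hy, _⟩ := h
  exact hy w hw

/-- Of two ancestors of a vertex, the one in the lower layer is an ancestor of the other one. -/
lemma IsAncestor.of_lt {L : Set V} {ℓ : V → ℕ} {x x' w : V} (hx : G.IsAncestor L ℓ x w)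
    (hx' : G.IsAncestor L ℓ x' w) (hlt : ℓ x < ℓ x') : G.IsAncestor L ℓ x x' := by
  obtain ⟨hxL, K, hK, hKc, hwK, hKl, y, hy, hyx⟩ := hx
  obtain ⟨hxL', K', hK', hKc', hwK', hKl', y', hy', hyx'⟩ := hx'
  refine ⟨hxL, insert x' (K ∪ K'), Set.insert_subset hxL' (Set.union_subset hK hK'),
    (hKc.union hKc' ⟨w, hwK, hwK'⟩).insert_adj (Or.inr hy') hyx', Or.inl rfl, ?_, y,
    Or.inr (Or.inl hy), hyx⟩
  rintro z (rfl | hz | hz)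
  · exact hlt
  · exact hKl z hz
  · exact hlt.trans (hKl' z hz)

namespace IsLayering

variable [LinearOrder V] {L : Set V} {ℓ : V → ℕ}

/-- The two connected sets share `w`; together with `x` and `x'` they form a connected set whose
lowest layer is `{x, x'}`. By `connOn_lowest` this pair is connected. -/
lemma adj_of_isAncestor [Finite V] (hG : G.IsElimOrdered) (h : G.IsLayering L ℓ) {x x' w : V}
    (hx : G.IsAncestor L ℓ x w) (hx' : G.IsAncestor L ℓ x' w) (hl : ℓ x = ℓ x') (hne : x ≠ x') :
    G.Adj x x' := by
  obtain ⟨hxL, K, hK, hKc, hwK, hKl, y, hy, hyx⟩ := hx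
  obtain ⟨hxL', K', hK', hKc', hwK', hKl', y', hy', hyx'⟩ := hx'
  have hc : G.ConnOn (insert x' (insert x (K ∪ K'))) :=
    ((hKc.union hKc' ⟨w, hwK, hwK'⟩).insert_adj (Or.inl hy) hyx).insert_adj
      (Or.inr (Or.inr hy')) hyx'
  have hsub : insert x' (insert x (K ∪ K')) ⊆ L :=
    Set.insert_subset hxL' (Set.insert_subset hxL (Set.union_subset hK hK'))
  have hmem : ∀ z ∈ insert x' (insert x (K ∪ K')), ℓ x ≤ ℓ z ∧ (ℓ z = ℓ x → z = x' ∨ z = x) := by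
    rintro z (rfl | rfl | hz | hz)
    · exact ⟨hl.le, fun _ => Or.inl rfl⟩
    · exact ⟨le_refl _, fun _ => Or.inr rfl⟩
    · have := hKl z hz
      exact ⟨this.le, fun e => by omega⟩
    · have := hKl' z hz
      exact ⟨by omega, fun e => by omega⟩
  have hlow := h.connOn_lowest hG (i := ℓ x) (Set.toFinite _).toFinset (by simpa using hsub)
    (by simpa using hc) (fun z hz => (hmem z (by simpa using hz)).1)
  obtain ⟨a, ha, b, hb, hab⟩ := hlow {x} (by simp) ⟨x, rfl⟩ ⟨x', by simp [hl, Ne.symm hne]⟩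
  rw [Set.mem_singleton_iff] at ha
  subst ha
  have hb2 := (hmem b (by simpa using hb.1.1)).2 hb.1.2
  rcases hb2 with rfl | rfl
  · exact hab
  · exact absurd rfl hab.ne

/-- Ancestors in one layer form a clique, which has at most two vertices in a linear forest, and
only `p` layers count. -/
lemma ncard_isAncestor_le [Finite V] (hG : G.IsElimOrdered) (h : G.IsLayering L ℓ)
    (hL : ∀ i, G.SimpleOn 1 {x | x ∈ L ∧ ℓ x = i}) (p : ℕ) (w : V) :
    {x | G.IsAncestor L ℓ x w ∧ ℓ w ≤ ℓ x + p}.ncard ≤ 2 * p := by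
  classical
  have := Fintype.ofFinite V
  rw [Set.ncard_eq_toFinset_card']
  set s := {x | G.IsAncestor L ℓ x w ∧ ℓ w ≤ ℓ x + p}.toFinset with hs
  have hmem : ∀ x, x ∈ s ↔ G.IsAncestor L ℓ x w ∧ ℓ w ≤ ℓ x + p := fun x => by simp [hs]
  have h1 : s.card ≤ 2 * (s.image ℓ).card := by
    refine Finset.card_le_mul_card_image s 2 fun i _ => ?_
    refine (hL i).clique_le _ ?_ ?_
    · intro x hx
      simp only [Finset.coe_filter, Set.mem_ofPred_eq, hmem] at hx
      exact ⟨hx.1.1.1, hx.2⟩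
    · intro x hx y hy hxy
      simp only [Finset.coe_filter, Set.mem_ofPred_eq, hmem] at hx hy
      exact h.adj_of_isAncestor hG hx.1.1 hy.1.1 (hx.2.trans hy.2.symm) hxy
  have h2 : s.image ℓ ⊆ Finset.Ico (ℓ w - p) (ℓ w) := by
    intro i hi
    obtain ⟨x, hx, rfl⟩ := Finset.mem_image.1 hi
    have h3 := (hmem x).1 hx
    have := h3.1.lt
    rw [Finset.mem_Ico]
    omega
  have h3 := Finset.card_le_card h2
  rw [Nat.card_Ico] at h3
  omega

/-- Consider the vertices reachable from `w` inside `S` above layer `j`. An edge leaving them ends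
in layer exactly `j`, because layers change by at most one along an edge. -/
lemma exists_ancestor (h : G.IsLayering L ℓ) {S : Set V} (hS : S ⊆ L) (hc : G.ConnOn S) {w u : V}
    (hw : w ∈ S) (hu : u ∈ S) {j : ℕ} (huj : ℓ u ≤ j) (hjw : j < ℓ w) :
    ∃ x ∈ S, ℓ x = j ∧ G.IsAncestor L ℓ x w := by
  obtain ⟨a, ha, b, hb, ⟨K, hK, hKc, hwK, hKl, haK⟩, hfb, hab⟩ := hc.exists_crossing
    (f := fun y => ∃ K ⊆ S, G.ConnOn K ∧ w ∈ K ∧ (∀ z ∈ K, j < ℓ z) ∧ y ∈ K)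
    ⟨w, hw, {w}, by simpa using hw, ConnOn.singleton w, rfl, by simpa using hjw, rfl⟩
    ⟨u, hu, by
      rintro ⟨K, _, _, _, h1, h2⟩
      have := h1 u h2
      omega⟩
  have hbj : ¬ j < ℓ b := by
    intro hbj
    refine hfb ⟨insert b K, Set.insert_subset hb hK, hKc.insert_adj haK hab, Or.inr hwK, ?_,
      Or.inl rfl⟩
    rintro z (rfl | hz)
    · exact hbj
    · exact hKl z hz
  have h1 := h.le_succ (hS hb) (hS ha) hab.symm
  have h2 := hKl a haK
  have hbl : ℓ b = j := by omega
  exact ⟨b, hb, hbl, hS hb, K, hK.trans hS, hKc, hwK, hbl ▸ hKl, a, haK, hab⟩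

end IsLayering

/-- Two vertices that lie in a common connected subset of a layer at distance at most `c`. -/
def NearInLayer (G : SimpleGraph V) (L : Set V) (ℓ : V → ℕ) (f : V → ℤ) (c : ℕ) (u v : V) : Prop :=
  u ≠ v ∧ |f u - f v| ≤ c ∧ ∃ S ⊆ L, (G.sameLayer ℓ).ConnOn S ∧ u ∈ S ∧ v ∈ S

/-- All the connected sets involved contain `v`, so positions are injective on their unions, and
only `2 * c + 1` positions are possible. -/
lemma ncard_nearInLayer_le [LinearOrder V] [Finite V] (hG : G.IsElimOrdered) {L : Set V}
    {ℓ : V → ℕ} {f : V → ℤ} (hf : (G.sameLayer ℓ).IsPosition L f) (c : ℕ) (v : V) :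
    {u | G.NearInLayer L ℓ f c u v}.ncard ≤ 2 * c + 1 := by
  have hinj : Set.InjOn f {u | G.NearInLayer L ℓ f c u v} := by
    rintro u ⟨_, _, S, hS, hSc, huS, hvS⟩ u' ⟨_, _, S', hS', hSc', huS', hvS'⟩ he
    exact hf.injOn (hG.sameLayer ℓ) (Set.union_subset hS hS') (hSc.union hSc' ⟨v, hvS, hvS'⟩)
      (Or.inl huS) (Or.inr huS') he
  rw [← hinj.ncard_image]
  have hsub : f '' {u | G.NearInLayer L ℓ f c u v} ⊆ (Finset.Icc (f v - c) (f v + c) : Finset ℤ) := by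
    rintro _ ⟨u, ⟨_, h1, _⟩, rfl⟩
    rw [abs_le] at h1
    rw [Finset.coe_Icc, Set.mem_Icc]
    omega
  have h1 := Set.ncard_le_ncard hsub (Finset.finite_toSet _)
  rw [Set.ncard_coe_finset, Int.card_Icc] at h1
  omega

/-- The colouring of graphs all of whose layers are linear forests. -/
lemma exists_centeredOn_of_forest_layers [LinearOrder V] [Finite V] (hG : G.IsElimOrdered)
    {L : Set V} {ℓ : V → ℕ} (h : G.IsLayering L ℓ)
    (hL : ∀ i, G.SimpleOn 1 {x | x ∈ L ∧ ℓ x = i}) {p R : ℕ} (hR : p + 2 ≤ 2 ^ R) :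
    ∃ φ : V → (Fin (p + 1) × Fin (R + 1)) ⊕ Fin (6 * p + 6), G.CenteredOn p φ L := by
  classical
  obtain ⟨f, hf⟩ := exists_isPosition (hG.sameLayer ℓ) (SimpleOn.sameLayer hL)
  obtain ⟨ρ, hρ⟩ := exists_ruler R
  obtain ⟨n, ⟨e⟩⟩ := Finite.exists_equiv_fin V
  let conf : V → V → Prop := fun u v =>
    (G.IsAncestor L ℓ u v ∧ ℓ v ≤ ℓ u + p) ∨ G.NearInLayer L ℓ f (2 * p + 2) u v
  -- The rank is lexicographic, layer first, so ancestors come earlier. The conflicts number at most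
  -- `2 * p` ancestors plus `2 * (2 * p + 2) + 1` near vertices, which is `6 * p + 5`.
  obtain ⟨g, hg⟩ := exists_greedy_coloring (fun v => ℓ v * n + e v) conf (6 * p + 5) (by
    intro v
    have h1 : {u | ℓ u * n + e u < ℓ v * n + e v ∧ conf u v} ⊆
        {u | G.IsAncestor L ℓ u v ∧ ℓ v ≤ ℓ u + p} ∪ {u | G.NearInLayer L ℓ f (2 * p + 2) u v} := by
      rintro u ⟨-, hu | hu⟩
      · exact Or.inl hu
      · exact Or.inr hu
    have h2 := Set.ncard_le_ncard h1
    have h3 := Set.ncard_union_le {u | G.IsAncestor L ℓ u v ∧ ℓ v ≤ ℓ u + p}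
      {u | G.NearInLayer L ℓ f (2 * p + 2) u v}
    have h4 := h.ncard_isAncestor_le hG hL p v
    have h5 := ncard_nearInLayer_le hG hf (2 * p + 2) v
    omega)
  have hganc : ∀ u v, G.IsAncestor L ℓ u v → ℓ v ≤ ℓ u + p → g u ≠ g v := by
    intro u v huv hp
    refine hg u v ?_ (Or.inl ⟨huv, hp⟩)
    have h1 := huv.lt
    have h2 := Nat.mul_le_mul_right n (Nat.succ_le_of_lt h1)
    have h3 := (e u).2
    rw [Nat.succ_mul] at h2
    omega
  have hgnear : ∀ u v, G.NearInLayer L ℓ f (2 * p + 2) u v → g u ≠ g v := by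
    intro u v huv
    have hne : ℓ u * n + e u ≠ ℓ v * n + e v := by
      intro he
      have h1 : (ℓ u * n + e u) % n = (ℓ v * n + e v) % n := by rw [he]
      rw [Nat.mul_add_mod', Nat.mul_add_mod', Nat.mod_eq_of_lt (e u).2, Nat.mod_eq_of_lt (e v).2] at h1
      exact huv.1 (e.injective (Fin.ext h1))
    rcases lt_or_gt_of_ne hne with hlt | hlt
    · exact hg u v hlt (Or.inr huv)
    · refine (hg v u hlt (Or.inr ⟨huv.1.symm, ?_, ?_⟩)).symm
      · rw [abs_sub_comm]; exact huv.2.1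
      · obtain ⟨S, h1, h2, h3, h4⟩ := huv.2.2
        exact ⟨S, h1, h2, h4, h3⟩
  let φ : V → (Fin (p + 1) × Fin (R + 1)) ⊕ Fin (6 * p + 6) := fun v =>
    if f v % 2 = 0 then Sum.inl (Fin.ofNat (p + 1) (ℓ v), ρ (f v / 2)) else Sum.inr (g v)
  have hφ : ∀ u v, φ u = φ v →
      (f u % 2 = 0 ∧ f v % 2 = 0 ∧ ℓ u % (p + 1) = ℓ v % (p + 1) ∧ ρ (f u / 2) = ρ (f v / 2)) ∨
      (f u % 2 ≠ 0 ∧ f v % 2 ≠ 0 ∧ g u = g v) := by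
    intro u v huv
    by_cases hu : f u % 2 = 0 <;> by_cases hv : f v % 2 = 0
    · left
      simp only [φ, hu, hv, if_true, Sum.inl.injEq, Prod.mk.injEq, Fin.ofNat, Fin.mk.injEq] at huv
      exact ⟨hu, hv, huv⟩
    · simp only [φ, hu, hv, if_true, if_false, reduceCtorEq] at huv
    · simp only [φ, hu, hv, if_true, if_false, reduceCtorEq] at huv
    · right
      simp only [φ, hu, hv, if_false, Sum.inr.injEq] at huv
      exact ⟨hu, hv, huv⟩
  have hmod : ∀ a d : ℕ, d ≤ p → (a + d) % (p + 1) = a % (p + 1) → d = 0 := by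
    intro a d hd he
    have h5 : a + d ≡ a + 0 [MOD (p + 1)] := he
    exact Nat.ModEq.eq_of_lt_of_lt (Nat.ModEq.add_left_cancel' _ h5) (by omega) (by omega)
  have hdist : ∀ u v, G.IsAncestor L ℓ u v → ℓ v ≤ ℓ u + p → φ u ≠ φ v := by
    intro u v huv hlp he
    rcases hφ u v he with h1 | h1
    · have h2 := huv.lt
      obtain ⟨d, hd⟩ := Nat.exists_eq_add_of_le h2.le
      rw [hd] at h1
      have := hmod _ d (by omega) h1.2.2.1.symm
      omega
    · exact hganc u v huv hlp h1.2.2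
  refine ⟨φ, fun S hS hne hconn => ?_⟩
  obtain ⟨m, hm, hmin⟩ := Set.exists_min_image S ℓ (Set.toFinite S) hne
  have : Nonempty V := ⟨m⟩
  -- A vertex `w` in layer `ℓ m + p` and one ancestor of it in each of the `p` layers from `ℓ m` on
  -- form a chain of ancestors, hence carry `p + 1` different colours.
  by_cases hhigh : ∃ w ∈ S, ℓ m + p ≤ ℓ w
  · left
    obtain ⟨w, hw, hwl⟩ : ∃ w ∈ S, ℓ w = ℓ m + p := by
      obtain ⟨w, hw, hwp⟩ := hhigh
      rcases hwp.lt_or_eq with hlt | heq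
      · obtain ⟨x, hx, hxl, -⟩ := h.exists_ancestor hS hconn hw hm (j := ℓ m + p) (by omega) hlt
        exact ⟨x, hx, hxl⟩
      · exact ⟨w, hw, heq.symm⟩
    have hlev : ∀ j ≤ p, ∃ x ∈ S, ℓ x = ℓ m + j ∧ (j = p → x = w) ∧
        (j < p → G.IsAncestor L ℓ x w) := by
      intro j hj
      rcases hj.lt_or_eq with hlt | rfl
      · obtain ⟨x, hx, hxl, hxa⟩ := h.exists_ancestor hS hconn hw hm (j := ℓ m + j) (by omega)
          (by omega)
        exact ⟨x, hx, hxl, fun e => absurd e hlt.ne, fun _ => hxa⟩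
      · exact ⟨w, hw, hwl, fun _ => rfl, fun e => absurd e (lt_irrefl _)⟩
    choose! x hxS hxl hxp hxa using hlev
    refine lt_encard_image_of_distinct x hxS fun j j' hjj hj' => ?_
    have h1 := hxl j (by omega)
    have h2 := hxl j' hj'
    refine hdist _ _ ?_ (by omega)
    have ha := hxa j (by omega) (by omega)
    rcases hj'.lt_or_eq with hlt | heq
    · exact IsAncestor.of_lt ha (hxa j' hj' hlt) (by omega)
    · rw [hxp j' hj' heq]
      exact ha
  push Not at hhigh
  have hlow : (G.sameLayer ℓ).ConnOn {x | x ∈ S ∧ ℓ x = ℓ m} := by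
    have := h.connOn_lowest hG (i := ℓ m) (Set.toFinite S).toFinset (by simpa using hS)
      (by simpa using hconn) (by simpa using hmin)
    have h2 : G.ConnOn {x | x ∈ S ∧ ℓ x = ℓ m} := by simpa using this
    exact h2.sameLayer (i := ℓ m) fun x hx => hx.2
  set P := {x | x ∈ S ∧ ℓ x = ℓ m} with hP
  have hPL : P ⊆ L := fun x hx => hS hx.1
  have hPm : m ∈ P := ⟨hm, rfl⟩
  have hPinj : Set.InjOn f P := hf.injOn (hG.sameLayer ℓ) hPL hlow
  obtain ⟨a, ha, hamin⟩ := Set.exists_min_image P f (Set.toFinite P) ⟨m, hPm⟩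
  obtain ⟨b, hb, hbmax⟩ := Set.exists_max_image P f (Set.toFinite P) ⟨m, hPm⟩
  have hPint : ∀ t : ℤ, f a ≤ t → t ≤ f b → ∃ x ∈ P, f x = t := fun t h1 h2 =>
    hf.exists_between hPL hlow ha hb h1 h2
  have hsame : ∀ v ∈ P, ∀ w ∈ S, ℓ w % (p + 1) = ℓ v % (p + 1) → w ∈ P := by
    intro v hv w hw he
    have h3 := hmin w hw
    have h4 := hhigh w hw
    obtain ⟨d, hd⟩ := Nat.exists_eq_add_of_le h3
    rw [hv.2, hd] at he
    have h5 := hmod _ _ (by omega) he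
    exact ⟨hw, by omega⟩
  by_cases hlong : f a + (2 * p + 2) ≤ f b
  · -- a long path contains many odd positions
    left
    have hodd : ∀ j ≤ p, ∃ x ∈ P, f x = 2 * (f a / 2) + 1 + 2 * j := by
      intro j hj
      exact hPint _ (by omega) (by omega)
    choose! x hxP hxf using hodd
    refine lt_encard_image_of_distinct x (fun j hj => (hxP j hj).1) fun j j' hjj hj' he => ?_
    have h1 := hxf j (by omega)
    have h2 := hxf j' hj'
    rcases hφ _ _ he with h3 | h3
    · omega
    · refine hgnear _ _ ⟨?_, ?_, P, hPL, hlow, hxP j (by omega), hxP j' hj'⟩ h3.2.2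
      · intro e
        rw [e] at h1
        omega
      · rw [abs_le]
        push_cast
        omega
  right
  -- The path is now short: the halves of its even positions fit into an interval covered by `p + 2
  -- ≤ 2 ^ R`, so the ruler gives a unique colour on the path. The layer residue excludes the
  -- vertices of `S` off the path.
  by_cases heven : (f a + 1) / 2 ≤ f b / 2
  · obtain ⟨j, h1, h2, h3⟩ := hρ ((f a + 1) / 2) (f b / 2) heven (by
      have : (p : ℤ) + 2 ≤ 2 ^ R := by exact_mod_cast hR
      omega)
    obtain ⟨v, hv, hvf⟩ := hPint (2 * j) (by omega) (by omega)
    refine ⟨v, hv.1, fun w hw hwv => ?_⟩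
    rcases hφ _ _ hwv with h4 | h4
    · have hwP := hsame v hv w hw h4.2.2.1
      have h5 := hamin w hwP
      have h6 := hbmax w hwP
      have h7 : f v / 2 = j := by omega
      rw [h7] at h4
      have h8 := h3 (f w / 2) (by omega) (by omega) h4.2.2.2
      exact hPinj hwP hv (by omega)
    · omega
  -- Without an even position the path is the single vertex `a`. It is then an ancestor of every
  -- other vertex of `S`, so its colour does not recur.
  · have hab : f a ≤ f b := hamin b hb
    have hPa : ∀ x ∈ P, x = a := by
      intro x hx
      have h5 := hamin x hx
      have h6 := hbmax x hx
      exact hPinj hx ha (by omega)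
    refine ⟨a, ha.1, fun w hw hwa => ?_⟩
    by_contra hne
    have hwP : w ∉ P := fun hwP => hne (hPa w hwP)
    have h3 := hmin w hw
    have h4 := hhigh w hw
    have h5 : ℓ w ≠ ℓ m := fun e => hwP ⟨hw, e⟩
    obtain ⟨x, hx, hxl, hxa⟩ := h.exists_ancestor hS hconn hw hm (j := ℓ m) (le_refl _) (by omega)
    have hxa' := hPa x ⟨hx, hxl⟩
    subst hxa'
    exact hdist x w hxa (by omega) hwa.symm

/-- Chordal graphs with the simplicity property have centered colourings with few colours. -/
lemma exists_centeredOn_of_simpleOn [LinearOrder V] [Finite V] (hG : G.IsElimOrdered) {p R : ℕ}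
    (hR : p + 2 ≤ 2 ^ R) (k : ℕ) (L : Set V) (hL : G.SimpleOn (k + 2) L) :
    ∃ φ : V → Fin ((p + 1) ^ k * ((p + 1) * (R + 1) + (6 * p + 6))), G.CenteredOn p φ L := by
  induction k generalizing L with
  | zero =>
    obtain ⟨ℓ, hℓ⟩ := exists_isLayering hG L
    obtain ⟨φ, hφ⟩ := exists_centeredOn_of_forest_layers hG hℓ
      (fun i => hℓ.simpleOn_layer hG le_rfl hL i) hR
    obtain ⟨ψ, hψ⟩ := hφ.exists_fin
    have hcard : Fintype.card ((Fin (p + 1) × Fin (R + 1)) ⊕ Fin (6 * p + 6)) =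
        (p + 1) ^ 0 * ((p + 1) * (R + 1) + (6 * p + 6)) := by simp
    rw [← hcard]
    exact ⟨ψ, hψ⟩
  | succ k ih =>
    obtain ⟨ℓ, hℓ⟩ := exists_isLayering hG L
    obtain ⟨φ, hφ⟩ := exists_centeredOn_of_layers hG hℓ
      fun i => ih _ (hℓ.simpleOn_layer hG (by omega) hL i)
    have hcard : (p + 1) ^ (k + 1) * ((p + 1) * (R + 1) + (6 * p + 6)) =
      (p + 1) * ((p + 1) ^ k * ((p + 1) * (R + 1) + (6 * p + 6))) := by ring
    rw [hcard]
    exact ⟨φ, hφ⟩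

end SimpleGraph

/-! ### From tree-decompositions to chordal graphs; the upper bound -/

namespace SimpleGraph

/-- In a finite tree, ordered by the distance from a root, every node has at most one smaller
neighbour. -/
lemma IsTree.exists_rank {ι : Type*} [Finite ι] {T : SimpleGraph ι} (hT : T.IsTree) :
    ∃ r : ι → ℕ, Function.Injective r ∧ ∀ s s' t, T.Adj s t → T.Adj s' t → r s < r t → r s' < r t →
      s = s' := by
  obtain ⟨n, ⟨e⟩⟩ := Finite.exists_equiv_fin ι
  obtain ⟨o⟩ := hT.connected.nonempty
  have hle : ∀ s t, T.dist o s * n + e s < T.dist o t * n + e t → T.dist o s ≤ T.dist o t := by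
    intro s t h
    by_contra! hlt
    have h2 := Nat.mul_le_mul_right n (Nat.succ_le_of_lt hlt)
    have h3 := (e t).2
    rw [Nat.succ_mul] at h2
    omega
  refine ⟨fun t => T.dist o t * n + e t, ?_, ?_⟩
  · intro s t h
    have h1 : (T.dist o s * n + e s) % n = (T.dist o t * n + e t) % n := congrArg (· % n) h
    rw [Nat.mul_add_mod', Nat.mul_add_mod', Nat.mod_eq_of_lt (e s).2,
      Nat.mod_eq_of_lt (e t).2] at h1
    exact e.injective (Fin.ext h1)
  · intro s s' t hs hs' h h'
    obtain ⟨q, hq, hql⟩ := (hT.connected o t).exists_path_of_dist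
    -- If `s` were not on `q`, its path from the root would be `q` extended by one edge, placing `s`
    -- farther away than `t`.
    have key : ∀ s, T.Adj s t → T.dist o s ≤ T.dist o t → s = q.penultimate := by
      intro s hs hle
      obtain ⟨p, hp, hpl⟩ := (hT.connected o s).exists_path_of_dist
      refine hT.isAcyclic.eq_penultimate_of_adj_end hq hs.symm ?_
      by_contra hsq
      have ht := hT.isAcyclic.mem_support_of_ne_mem_support_of_adj_of_isPath hp hq hs hsq
      have h1 := hT.isAcyclic.path_concat hq hp hs.symm ht
      have h2 := congrArg Walk.length h1
      rw [Walk.length_concat] at h2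
      omega
    rw [key s hs (hle s t h), key s' hs' (hle s' t h')]

/-- In an ordered tree, a node of a subtree that is not its smallest node has a smaller neighbour in
the subtree. -/
lemma ConnOn.exists_smaller_adj {ι : Type*} {T : SimpleGraph ι} {r : ι → ℕ}
    (hr : Function.Injective r)
    (hT : ∀ s s' t, T.Adj s t → T.Adj s' t → r s < r t → r s' < r t → s = s')
    (S : Finset ι) (hS : T.ConnOn (S : Set ι)) {m t : ι} (hm : m ∈ S) (ht : t ∈ S)
    (hmt : r m < r t) : ∃ s ∈ S, r s < r t ∧ T.Adj s t := by
  classical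
  induction hn : S.card generalizing S with
  | zero =>
    rw [Finset.card_eq_zero] at hn
    subst hn
    exact absurd ht (Finset.notMem_empty _)
  | succ n ih =>
    obtain ⟨a, ha, hmax⟩ := S.exists_max_image r ⟨t, ht⟩
    have hlt : ∀ x ∈ S, x ≠ a → r x < r a := fun x hx hxa =>
      lt_of_le_of_ne (hmax x hx) fun h => hxa (hr h)
    by_cases hat : a = t
    · subst hat
      obtain ⟨b, hb, c, hc, hbc⟩ := hS {a} (by simpa using ht) ⟨a, rfl⟩
        ⟨m, hm, fun h => by rw [Set.mem_singleton_iff.1 h] at hmt; exact lt_irrefl _ hmt⟩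
      rw [Set.mem_singleton_iff] at hb
      subst hb
      exact ⟨c, hc.1, hlt c hc.1 hc.2, hbc.symm⟩
    -- The node of largest rank has at most one neighbour in the subtree, so removing it preserves
    -- connectivity.
    · have hconn : T.ConnOn ((S.erase a : Finset ι) : Set ι) := by
        rw [Finset.coe_erase]
        exact hS.diff_simplicial fun x hx y hy hxy hxa hya =>
          absurd (hT x y a hxa hya (hlt x hx hxa.ne) (hlt y hy hya.ne)) hxy
      have hma : m ≠ a := by
        rintro rfl
        have := hmax t ht
        omega
      obtain ⟨s, hs, h1, h2⟩ := ih (S.erase a) hconn (Finset.mem_erase.2 ⟨hma, hm⟩)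
        (Finset.mem_erase.2 ⟨Ne.symm hat, ht⟩) (by rw [Finset.card_erase_of_mem ha]; omega)
      exact ⟨s, Finset.mem_of_mem_erase hs, h1, h2⟩

variable {V : Type*} {G : SimpleGraph V}

/-- The chordal graph obtained by making every bag a clique. -/
def TreeDecomposition.completion {ι : Type*} (D : G.TreeDecomposition ι) : SimpleGraph V where
  Adj u v := u ≠ v ∧ ∃ t, u ∈ D.bag t ∧ v ∈ D.bag t
  symm := ⟨fun _ _ ⟨h, t, h1, h2⟩ => ⟨h.symm, t, h2, h1⟩⟩
  loopless := ⟨fun _ h => h.1 rfl⟩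

namespace TreeDecomposition

variable {ι : Type*} (D : G.TreeDecomposition ι)

lemma le_completion : G ≤ D.completion := fun u v h => ⟨h.ne, D.edge_mem u v h⟩

/-- There is an ordering of the vertices such that each vertex shares a fixed bag with all of its
smaller neighbours in the completion. -/
lemma exists_order [Finite V] [Finite ι] : ∃ r : V → ℕ, Function.Injective r ∧ ∃ top : V → ι,
    (∀ v, v ∈ D.bag (top v)) ∧
    ∀ u v, r u < r v → D.completion.Adj u v → u ∈ D.bag (top v) := by
  classical
  obtain ⟨r, hr, hT⟩ := D.isTree.exists_rank
  obtain ⟨n, ⟨e⟩⟩ := Finite.exists_equiv_fin V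
  have hconn : ∀ v, D.tree.ConnOn {t | v ∈ D.bag t} := fun v =>
    connOn_of_induce_connected (D.connected v)
  have hmin : ∀ v, ∃ t, v ∈ D.bag t ∧ ∀ s, v ∈ D.bag s → r t ≤ r s := by
    intro v
    obtain ⟨⟨t₀, ht₀⟩⟩ := (D.connected v).nonempty
    obtain ⟨t, ht, h⟩ := Set.exists_min_image {t | v ∈ D.bag t} r (Set.toFinite _) ⟨t₀, ht₀⟩
    exact ⟨t, ht, h⟩
  choose top htop htopmin using hmin
  have hpar : ∀ v t, v ∈ D.bag t → t ≠ top v → ∃ s, v ∈ D.bag s ∧ r s < r t ∧ D.tree.Adj s t := by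
    intro v t ht hne
    have hlt : r (top v) < r t := lt_of_le_of_ne (htopmin v t ht) fun h => hne (hr h).symm
    obtain ⟨s, hs, h1, h2⟩ := ConnOn.exists_smaller_adj hr hT
      (Set.toFinite {t | v ∈ D.bag t}).toFinset (by simpa using hconn v) (m := top v) (t := t)
      (by simpa using htop v) (by simpa using ht) hlt
    exact ⟨s, by simpa using hs, h1, h2⟩
  -- Vertices are ordered by the rank of their top nodes, with ties broken by `e`.
  refine ⟨fun v => r (top v) * n + e v, ?_, top, htop, ?_⟩
  · intro s t h
    have h1 : (r (top s) * n + e s) % n = (r (top t) * n + e t) % n := congrArg (· % n) h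
    rw [Nat.mul_add_mod', Nat.mul_add_mod', Nat.mod_eq_of_lt (e s).2,
      Nat.mod_eq_of_lt (e t).2] at h1
    exact e.injective (Fin.ext h1)
  · rintro u v hlt ⟨hne, t₀, hut₀, hvt₀⟩
    have hle : r (top u) ≤ r (top v) := by
      by_contra! hlt'
      have h2 := Nat.mul_le_mul_right n (Nat.succ_le_of_lt hlt')
      have h3 := (e v).2
      rw [Nat.succ_mul] at h2
      simp only at hlt
      omega
    -- If the common node of smallest rank were the top of neither vertex, its unique smaller
    -- neighbour would be a common node too.
    obtain ⟨t, ⟨hut, hvt⟩, ht⟩ := Set.exists_min_image {t | u ∈ D.bag t ∧ v ∈ D.bag t} r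
      (Set.toFinite _) ⟨t₀, hut₀, hvt₀⟩
    by_cases h1 : t = top v
    · exact h1 ▸ hut
    by_cases h2 : t = top u
    · have := htopmin v t hvt
      rw [h2] at this
      have : top u = top v := hr (le_antisymm hle this)
      exact this ▸ htop u
    obtain ⟨s, hs, hsl, hst⟩ := hpar u t hut h2
    obtain ⟨s', hs', hsl', hst'⟩ := hpar v t hvt h1
    have := hT s s' t hst hst' hsl hsl'
    subst this
    have := ht s ⟨hs, hs'⟩
    omega

/-- The completion of a `k`-simple tree-decomposition is a chordal graph with the simplicity
property. -/
lemma exists_elimOrdered_simpleOn [Finite V] [Finite ι] {k : ℕ} (hD : D.IsSimple k) :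
    ∃ _ : LinearOrder V, D.completion.IsElimOrdered ∧ D.completion.SimpleOn k Set.univ := by
  classical
  obtain ⟨r, hr, top, htop, hback⟩ := D.exists_order
  let _ : LinearOrder V := LinearOrder.lift' r hr
  have hlt : ∀ u v : V, u < v → r u < r v := fun u v h => h
  have hbag : ∀ s : Finset V, s.Nonempty → D.completion.IsClique (s : Set V) →
      ∃ t, (s : Set V) ⊆ D.bag t := by
    intro s hne hs
    refine ⟨top (s.max' hne), fun x hx => ?_⟩
    by_cases hxm : x = s.max' hne
    · rw [← hxm]; exact htop x
    · exact hback _ _ (hlt _ _ (lt_of_le_of_ne (s.le_max' x hx) hxm)) (hs hx (s.max'_mem hne) hxm)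
  refine ⟨inferInstance, ?_, ?_, ?_⟩
  · intro u v w huw hvw huv hu hv
    exact ⟨huv, top w, hback u w (hlt _ _ huw) hu, hback v w (hlt _ _ hvw) hv⟩
  · intro s _ hs
    rcases s.eq_empty_or_nonempty with rfl | hne
    · simp
    obtain ⟨t, ht⟩ := hbag s hne hs
    have h1 := (Set.encard_le_encard ht).trans (hD.1 t)
    rw [Set.encard_coe_eq_coe_finsetCard] at h1
    exact_mod_cast h1
  · intro X _ hX hcard a _ b _ c _ ha hb hc
    by_contra! hne
    obtain ⟨hab, hac, hbc⟩ := hne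
    -- A clique of `k + 1` vertices fills its bag completely. Three common neighbours of `X` thus
    -- give three different nodes whose bags contain `X`.
    have hnode : ∀ a, (∀ x ∈ X, D.completion.Adj a x) →
        ∃ t, D.bag t = ((insert a X : Finset V) : Set V) := by
      intro a ha
      have haX : a ∉ X := fun h => (ha a h).ne rfl
      obtain ⟨t, ht⟩ := hbag (insert a X) ⟨a, by simp⟩ (by
        rw [Finset.coe_insert, isClique_insert]
        exact ⟨hX, fun x hx _ => ha x hx⟩)
      refine ⟨t, ((Finset.finite_toSet _).eq_of_subset_of_encard_le ht ?_).symm⟩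
      rw [Set.encard_coe_eq_coe_finsetCard, Finset.card_insert_of_notMem haX, hcard]
      exact_mod_cast hD.1 t
    have hdiff : ∀ a b s t, a ≠ b → (∀ x ∈ X, D.completion.Adj a x) →
        D.bag s = ((insert a X : Finset V) : Set V) →
        D.bag t = ((insert b X : Finset V) : Set V) → s ≠ t := by
      rintro a b s t hab ha hs ht rfl
      have h1 : a ∈ D.bag s := by rw [hs]; simp
      rw [ht, Finset.mem_coe, Finset.mem_insert] at h1
      rcases h1 with h1 | h1
      · exact hab h1
      · exact (ha a h1).ne rfl
    obtain ⟨ta, hta⟩ := hnode a ha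
    obtain ⟨tb, htb⟩ := hnode b hb
    obtain ⟨tc, htc⟩ := hnode c hc
    have hsub : ({ta, tb, tc} : Set ι) ⊆ {t | (X : Set V) ⊆ D.bag t} := by
      rintro t (rfl | rfl | rfl)
      · rw [Set.mem_ofPred_eq, hta]; simp
      · rw [Set.mem_ofPred_eq, htb]; simp
      · rw [Set.mem_ofPred_eq, htc]; simp
    have h3 : ({ta, tb, tc} : Set ι).encard = 3 := Set.encard_eq_three.2
      ⟨ta, tb, tc, hdiff a b ta tb hab ha hta htb, hdiff a c ta tc hac ha hta htc,
        hdiff b c tb tc hbc hb htb htc, rfl⟩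
    have h4 := (Set.encard_le_encard hsub).trans (hD.2 X hcard)
    rw [h3] at h4
    exact absurd h4 (by norm_num)

end TreeDecomposition

/-- For `k < k'` the second condition becomes vacuous: a `k'`-clique together with a common
neighbour is too large a clique. -/
lemma SimpleOn.mono {k k' : ℕ} {L : Set V} (h : G.SimpleOn k L) (hk : k ≤ k') :
    G.SimpleOn k' L := by
  classical
  rcases hk.lt_or_eq with hlt | rfl
  · refine ⟨fun s hs hc => (h.clique_le s hs hc).trans (by omega), ?_⟩
    intro X hX hXc hcard a ha b hb c hc h1 h2 h3
    have haX : a ∉ X := fun hm => (h1 a hm).ne rfl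
    have := h.clique_le (insert a X)
      (by rw [Finset.coe_insert]; exact Set.insert_subset ha hX) (by
        rw [Finset.coe_insert, isClique_insert]
        exact ⟨hXc, fun x hx _ => h1 x hx⟩)
    rw [Finset.card_insert_of_notMem haX] at this
    omega
  · exact h

lemma exists_hasSimpleTreeDecomposition {k : ℕ} (h : G.simpleTreewidth ≤ k) :
    ∃ k' ≤ k, 1 ≤ k' ∧ G.HasSimpleTreeDecomposition k' := by
  by_contra! hno
  have h1 : ((k + 1 : ℕ) : ℕ∞) ≤ G.simpleTreewidth := by
    refine le_iInf₂ fun k' hk' => ?_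
    have : k < k' := by
      by_contra! hle
      exact hno k' hle hk'.1 hk'.2
    exact_mod_cast this
  have h2 := h1.trans h
  have h3 : k + 1 ≤ k := by exact_mod_cast h2
  omega

/-- The number of colours as a function of the simple treewidth. -/
lemma exists_centeredColoring_of_simpleTreewidth_le [Finite V] {k p R : ℕ}
    (h : G.simpleTreewidth ≤ (k + 2 : ℕ)) (hR : p + 2 ≤ 2 ^ R) :
    ∃ φ : V → Fin ((p + 1) ^ k * ((p + 1) * (R + 1) + (6 * p + 6))), G.IsCenteredColoring p φ := by
  obtain ⟨k', hk', -, ι, hι, D, hD⟩ := exists_hasSimpleTreeDecomposition h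
  obtain ⟨_, hG, hL⟩ := D.exists_elimOrdered_simpleOn hD
  obtain ⟨φ, hφ⟩ := exists_centeredOn_of_simpleOn hG hR k Set.univ (hL.mono hk')
  exact ⟨φ, (hφ.of_le D.le_completion).isCenteredColoring⟩

/-- A clique with `k + 1` vertices forces the simple treewidth to be at least `k`. -/
lemma le_simpleTreewidth_of_clique [Finite V] {k : ℕ} (s : Finset V) (hs : G.IsClique (s : Set V))
    (hcard : s.card = k + 1) : (k : ℕ∞) ≤ G.simpleTreewidth := by
  refine le_iInf₂ fun k' hk' => ?_
  obtain ⟨-, ι, hι, D, hD⟩ := hk'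
  obtain ⟨_, hG, hL⟩ := D.exists_elimOrdered_simpleOn hD
  have := hL.clique_le s (Set.subset_univ _) (hs.mono D.le_completion)
  exact_mod_cast (by omega : k ≤ k')

/-- The upper bound: `O(p ^ (k - 1) * log p)` colours suffice. -/
lemma exists_upper_bound (k : ℕ) (hk : 2 ≤ k) :
    ∃ C : ℝ, 0 < C ∧ ∀ p : ℕ, 2 ≤ p →
      ∀ (V : Type*) [Finite V] (G : SimpleGraph V), G.simpleTreewidth ≤ (k : ℕ∞) →
        ∃ (m : ℕ) (φ : V → Fin m), G.IsCenteredColoring p φ ∧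
          (m : ℝ) ≤ C * ((p : ℝ) ^ (k - 1) * Real.log (p : ℝ)) := by
  obtain ⟨k, rfl⟩ := Nat.exists_eq_add_of_le' hk
  have hlog2 : 0 < Real.log 2 := Real.log_pos (by norm_num)
  -- Here `k` is the treewidth bound minus two. The colour count equals `(p + 1) ^ (k + 1) *
  -- (Nat.log 2 p + 9)`, and `p + 1 ≤ 2 * p`, while the last factor is at most ten times `log p /
  -- log 2`.
  refine ⟨2 ^ (k + 1) * (10 / Real.log 2), by positivity, fun p hp V _ G hG => ?_⟩
  have hR : p + 2 ≤ 2 ^ (Nat.log 2 p + 2) := by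
    have := Nat.lt_pow_succ_log_self (b := 2) (by norm_num) p
    rw [pow_succ]
    rw [Nat.succ_eq_add_one] at this
    omega
  obtain ⟨φ, hφ⟩ := exists_centeredColoring_of_simpleTreewidth_le hG hR
  refine ⟨_, φ, hφ, ?_⟩
  have hp' : (2 : ℝ) ≤ p := by exact_mod_cast hp
  have h1 : (Nat.log 2 p : ℝ) ≤ Real.log p / Real.log 2 := by
    rw [le_div_iff₀ hlog2, ← Real.log_pow]
    refine Real.log_le_log (by positivity) ?_
    exact_mod_cast Nat.pow_log_le_self 2 (by omega)
  have h2 : 1 ≤ Real.log p / Real.log 2 := by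
    rw [le_div_iff₀ hlog2, one_mul]
    exact Real.log_le_log (by norm_num) hp'
  have h3 : (p : ℝ) + 1 ≤ 2 * p := by linarith
  have h4 : (((p + 1) ^ k * ((p + 1) * (Nat.log 2 p + 2 + 1) + (6 * p + 6)) : ℕ) : ℝ) =
      (p + 1) ^ (k + 1) * (Nat.log 2 p + 9) := by
    push_cast
    ring
  rw [h4]
  calc ((p : ℝ) + 1) ^ (k + 1) * (Nat.log 2 p + 9)
      ≤ (2 * p) ^ (k + 1) * (10 * (Real.log p / Real.log 2)) := by
        gcongr
        linarith
    _ = 2 ^ (k + 1) * (10 / Real.log 2) * ((p : ℝ) ^ (k + 2 - 1) * Real.log p) := by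
        rw [mul_pow, show k + 2 - 1 = k + 1 by omega]
        ring

end SimpleGraph

/-! ### Available colours and the lower bound for rich graphs -/

namespace SimpleGraph

/-- Infinitely many elements of `W` satisfy `P`. -/
def Recurrent {V : Type*} (W : Set V) (P : V → Prop) : Prop := ∀ F : Finset V, ∃ y ∈ W, y ∉ F ∧ P y

lemma Recurrent.mono {V : Type*} {W W' : Set V} {P Q : V → Prop} (h : Recurrent W P) (hW : W ⊆ W')
    (hPQ : ∀ y, P y → Q y) : Recurrent W' Q := by
  intro F
  obtain ⟨y, hy, hyF, hP⟩ := h F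
  exact ⟨y, hW hy, hyF, hPQ y hP⟩

variable {V C : Type*} [DecidableEq V] [DecidableEq C] {G : SimpleGraph V} {φ : V → C} {U : Set V}

lemma ConnOn.union_neighbors {T : Set V} {x : V} (hT : G.ConnOn T) (hx : x ∈ T) (Z : Finset V)
    (hZ : ∀ z ∈ Z, G.Adj x z) : G.ConnOn (T ∪ Z) := by
  induction Z using Finset.induction_on with
  | empty => simpa using hT
  | insert a s has ih =>
    have h1 := ih fun z hz => hZ z (Finset.mem_insert_of_mem hz)
    have h2 := h1.insert_adj (Or.inl hx) (hZ a (Finset.mem_insert_self _ _))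
    rwa [← Set.union_insert, ← Finset.coe_insert] at h2

/-- The centered colouring condition for the finite connected subsets of `U`. -/
def FinCenteredOn (G : SimpleGraph V) (p : ℕ) (φ : V → C) (U : Set V) : Prop :=
  ∀ S : Finset V, (S : Set V) ⊆ U → S.Nonempty → G.ConnOn (S : Set V) →
    p < (S.image φ).card ∨ ∃ v ∈ S, ∀ w ∈ S, φ w = φ v → w = v

/-- The vertex `x` can be connected, outside of any finite set, to sets with colours `E ∪ D'` for
every `D' ⊆ D`. -/
def Available (G : SimpleGraph V) (φ : V → C) (U : Set V) (x : V) (E D : Finset C) : Prop :=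
  ∀ F : Finset V, ∀ D' ⊆ D, ∃ Y : Finset V, (Y : Set V) ⊆ U ∧ Disjoint Y F ∧
    G.ConnOn (insert x (Y : Set V)) ∧ Y.image φ = E ∪ D'

/-- Iterated neighbourhood structure whose innermost level is a ray. -/
def Rich (G : SimpleGraph V) : ℕ → Set V → Prop
  | 0, W => ∃ ray : ℕ → V, Function.Injective ray ∧ (∀ n, ray n ∈ W) ∧
      ∀ n, G.Adj (ray n) (ray (n + 1))
  | j + 1, W => W.Nonempty ∧ ∀ x ∈ W, ∃ W' ⊆ W, (∀ y ∈ W', G.Adj x y) ∧ Rich G j W'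

/-- Applied twice in a row, this makes every colour of `E ∪ D'` occur on two new vertices, so that
none of them can be a unique colour. -/
lemma Available.extend {x : V} {E D : Finset C} (h : G.Available φ U x E D) (T : Finset V)
    (hTU : (T : Set V) ⊆ U) (hT : G.ConnOn (T : Set V)) (hx : x ∈ T) {D' : Finset C} (hD' : D' ⊆ D) :
    ∃ T' : Finset V, T ⊆ T' ∧ (T' : Set V) ⊆ U ∧ G.ConnOn (T' : Set V) ∧
      (∀ v ∈ T', v ∉ T → φ v ∈ E ∪ D') ∧ ∀ c ∈ E ∪ D', ∃ w ∈ T', w ∉ T ∧ φ w = c := by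
  obtain ⟨Y, hYU, hYT, hYc, hYφ⟩ := h T D' hD'
  refine ⟨T ∪ Y, Finset.subset_union_left, ?_, ?_, ?_, ?_⟩
  · rw [Finset.coe_union]
    exact Set.union_subset hTU hYU
  · have h1 := hT.union hYc ⟨x, hx, Or.inl rfl⟩
    rw [Set.union_insert, ← Set.insert_union, Set.insert_eq_of_mem (Finset.mem_coe.2 hx)] at h1
    rwa [Finset.coe_union]
  · intro v hv hvT
    rw [← hYφ]
    exact Finset.mem_image_of_mem φ ((Finset.mem_union.1 hv).resolve_left hvT)
  · intro c hc
    rw [← hYφ] at hc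
    obtain ⟨w, hw, rfl⟩ := Finset.mem_image.1 hc
    exact ⟨w, Finset.mem_union_right _ hw, Finset.disjoint_left.1 hYT hw, rfl⟩

/-- A small connected set has a vertex of unique colour which is not available at two of its
vertices. -/
lemma exists_center_not_available {p : ℕ} (hφ : G.FinCenteredOn p φ U) {S : Finset V}
    (hSU : (S : Set V) ⊆ U) (hS : G.ConnOn (S : Set V)) {x x' : V} (hx : x ∈ S) (hx' : x' ∈ S)
    {E D E' D' : Finset C} (h : G.Available φ U x E D) (h' : G.Available φ U x' E' D')
    (hcard : S.card + E.card + E'.card ≤ p) :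
    ∃ v ∈ S, (∀ w ∈ S, φ w = φ v → w = v) ∧ φ v ∉ E ∪ D ∧ φ v ∉ E' ∪ D' := by
  -- Two fresh copies are attached at `x` and two at `x'`. From `D` and `D'` only colours already
  -- present on `S` are used, so the new colours come from `E` and `E'` and the total stays at most
  -- `p`.
  obtain ⟨T₁, s₁, hU₁, hc₁, hv₁, hw₁⟩ := h.extend S hSU hS hx
    (D' := D ∩ S.image φ) Finset.inter_subset_left
  obtain ⟨T₂, s₂, hU₂, hc₂, hv₂, hw₂⟩ := h.extend T₁ hU₁ hc₁ (s₁ hx)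
    (D' := D ∩ S.image φ) Finset.inter_subset_left
  obtain ⟨T₃, s₃, hU₃, hc₃, hv₃, hw₃⟩ := h'.extend T₂ hU₂ hc₂ (s₂ (s₁ hx'))
    (D' := D' ∩ S.image φ) Finset.inter_subset_left
  obtain ⟨T₄, s₄, hU₄, hc₄, hv₄, hw₄⟩ := h'.extend T₃ hU₃ hc₃ (s₃ (s₂ (s₁ hx')))
    (D' := D' ∩ S.image φ) Finset.inter_subset_left
  have hmem : ∀ v ∈ T₄, v ∉ S → φ v ∈ E ∪ (D ∩ S.image φ) ∨ φ v ∈ E' ∪ (D' ∩ S.image φ) := by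
    intro v hv hvS
    by_cases h1 : v ∈ T₁
    · exact Or.inl (hv₁ v h1 hvS)
    by_cases h2 : v ∈ T₂
    · exact Or.inl (hv₂ v h2 h1)
    by_cases h3 : v ∈ T₃
    · exact Or.inr (hv₃ v h3 h2)
    · exact Or.inr (hv₄ v hv h3)
  rcases hφ T₄ hU₄ ⟨x, s₄ (s₃ (s₂ (s₁ hx)))⟩ hc₄ with h1 | ⟨v, hv, hu⟩
  · exfalso
    have hsub : T₄.image φ ⊆ S.image φ ∪ E ∪ E' := by
      intro c hc
      obtain ⟨v, hv, rfl⟩ := Finset.mem_image.1 hc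
      by_cases hvS : v ∈ S
      · simp only [Finset.mem_union]
        exact Or.inl (Or.inl (Finset.mem_image_of_mem φ hvS))
      · have := hmem v hv hvS
        simp only [Finset.mem_union, Finset.mem_inter] at this ⊢
        tauto
    have h2 := Finset.card_le_card hsub
    have h3 := Finset.card_union_le (S.image φ ∪ E) E'
    have h4 := Finset.card_union_le (S.image φ) E
    have h5 := Finset.card_image_le (s := S) (f := φ)
    omega
  · have hno : φ v ∉ E ∪ (D ∩ S.image φ) := by
      intro hc
      obtain ⟨w, hw, hwS, hwv⟩ := hw₁ _ hc
      obtain ⟨w', hw', hwS', hwv'⟩ := hw₂ _ hc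
      have e1 := hu w (s₄ (s₃ (s₂ hw))) hwv
      have e2 := hu w' (s₄ (s₃ hw')) hwv'
      exact hwS' (e2 ▸ e1 ▸ hw)
    have hno' : φ v ∉ E' ∪ (D' ∩ S.image φ) := by
      intro hc
      obtain ⟨w, hw, hwS, hwv⟩ := hw₃ _ hc
      obtain ⟨w', hw', hwS', hwv'⟩ := hw₄ _ hc
      have e1 := hu w (s₄ hw) hwv
      have e2 := hu w' hw' hwv'
      exact hwS' (e2 ▸ e1 ▸ hw)
    have hvS : v ∈ S := by
      by_contra hvS
      exact (hmem v hv hvS).elim hno hno'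
    have hvφ := Finset.mem_image_of_mem φ hvS
    refine ⟨v, hvS, fun w hw => hu w (s₄ (s₃ (s₂ (s₁ hw)))), ?_, ?_⟩
    · simp only [Finset.mem_union, Finset.mem_inter, not_or, not_and] at hno ⊢
      exact ⟨hno.1, fun hD => hno.2 hD hvφ⟩
    · simp only [Finset.mem_union, Finset.mem_inter, not_or, not_and] at hno' ⊢
      exact ⟨hno'.1, fun hD => hno'.2 hD hvφ⟩

lemma connOn_ray_segment {ray : ℕ → V} (hadj : ∀ n, G.Adj (ray n) (ray (n + 1))) (a n : ℕ) :
    G.ConnOn (((Finset.Ico a (a + n)).image ray : Finset V) : Set V) := by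
  induction n with
  | zero =>
    rintro A - - ⟨b, hb, -⟩
    simp at hb
  | succ n ih =>
    rcases Nat.eq_zero_or_pos n with rfl | hn
    · simpa using ConnOn.singleton (ray a)
    · obtain ⟨m, rfl⟩ := Nat.exists_eq_add_of_le' hn
      have h1 := ih.insert_adj (x := ray (a + m)) (y := ray (a + (m + 1)))
        (by
          rw [Finset.coe_image]
          exact ⟨a + m, by simp, rfl⟩) (hadj (a + m))
      have h2 : Finset.Ico a (a + (m + 1 + 1)) = insert (a + (m + 1)) (Finset.Ico a (a + (m + 1))) := by
        ext t
        simp only [Finset.mem_insert, Finset.mem_Ico]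
        omega
      rw [h2, Finset.image_insert, Finset.coe_insert]
      exact h1

/-- A segment of length `2 ^ n` of a ray has a vertex at which `n` colours of the segment are not
available. -/
lemma exists_hub {p h N n₀ : ℕ} (hφ : G.FinCenteredOn p φ U) {ray : ℕ → V}
    (hinj : Function.Injective ray) (hadj : ∀ n, G.Adj (ray n) (ray (n + 1)))
    (hU : ∀ n, ray n ∈ U) (E D : ℕ → Finset C)
    (hav : ∀ t ≥ N, G.Available φ U (ray t) (E t) (D t)) (hE : ∀ t ≥ N, (E t).card ≤ h)
    (hp : 2 ^ n₀ + 2 * h ≤ p) (n : ℕ) (hn : n ≤ n₀) (a : ℕ) (ha : N ≤ a) :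
    ∃ t ∈ Finset.Ico a (a + 2 ^ n), ∃ B : Finset C, B.card = n ∧
      B ⊆ (Finset.Ico a (a + 2 ^ n)).image (φ ∘ ray) ∧ Disjoint B (E t ∪ D t) := by
  induction n generalizing a with
  | zero => exact ⟨a, by simp, ∅, by simp⟩
  | succ n ih =>
    set S := Finset.Ico a (a + 2 ^ (n + 1)) with hS
    have hpow : 2 ^ (n + 1) = 2 ^ n + 2 ^ n := by ring
    have hpos : 0 < 2 ^ n := by positivity
    let good : ℕ → ℕ → Prop := fun t v =>
      (∀ w ∈ S, φ (ray w) = φ (ray v) → w = v) ∧ φ (ray v) ∉ E t ∪ D t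
    -- The hub of one half gains a colour from the other half. That colour is new because it is
    -- unique in the whole segment.
    have step : ∀ b b' : ℕ, N ≤ b → Finset.Ico b (b + 2 ^ n) ⊆ S →
        Finset.Ico b' (b' + 2 ^ n) ⊆ S →
        Disjoint (Finset.Ico b (b + 2 ^ n)) (Finset.Ico b' (b' + 2 ^ n)) →
        (∀ t ∈ Finset.Ico b (b + 2 ^ n), ∃ v ∈ Finset.Ico b' (b' + 2 ^ n), good t v) →
        ∃ t ∈ S, ∃ B : Finset C, B.card = n + 1 ∧ B ⊆ S.image (φ ∘ ray) ∧
          Disjoint B (E t ∪ D t) := by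
      intro b b' hb hbS hbS' hdis hgood
      obtain ⟨t, ht, B, hB, hBs, hBd⟩ := ih (by omega) b hb
      obtain ⟨v, hv, hvu, hvE⟩ := hgood t ht
      refine ⟨t, hbS ht, insert (φ (ray v)) B, ?_, ?_, ?_⟩
      · rw [Finset.card_insert_of_notMem, hB]
        intro hmem
        obtain ⟨w, hw, hwv⟩ := Finset.mem_image.1 (hBs hmem)
        have := hvu w (hbS hw) hwv
        subst this
        exact Finset.disjoint_left.1 hdis hw hv
      · exact Finset.insert_subset (Finset.mem_image.2 ⟨v, hbS' hv, rfl⟩)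
          (hBs.trans (Finset.image_subset_image hbS))
      · rw [Finset.disjoint_insert_left]
        exact ⟨hvE, hBd⟩
    have hL : Finset.Ico a (a + 2 ^ n) ⊆ S := Finset.Ico_subset_Ico_right (by omega)
    have hR : Finset.Ico (a + 2 ^ n) (a + 2 ^ n + 2 ^ n) ⊆ S :=
      Finset.Ico_subset_Ico (by omega) (by omega)
    have hLR : Disjoint (Finset.Ico a (a + 2 ^ n)) (Finset.Ico (a + 2 ^ n) (a + 2 ^ n + 2 ^ n)) :=
      Finset.Ico_disjoint_Ico_consecutive _ _ _
    by_cases h1 : ∀ t ∈ Finset.Ico a (a + 2 ^ n),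
        ∃ v ∈ Finset.Ico (a + 2 ^ n) (a + 2 ^ n + 2 ^ n), good t v
    · exact step a (a + 2 ^ n) ha hL hR hLR h1
    by_cases h2 : ∀ t ∈ Finset.Ico (a + 2 ^ n) (a + 2 ^ n + 2 ^ n),
        ∃ v ∈ Finset.Ico a (a + 2 ^ n), good t v
    · exact step (a + 2 ^ n) a (by omega) hR hL hLR.symm h2
    -- Now `t` in the left half and `t'` in the right half both lack a good vertex opposite to them.
    -- The unique vertex obtained for this pair lies in one half and is good for the member of the
    -- pair in the other half.
    exfalso
    push Not at h1 h2
    obtain ⟨t, ht, h1⟩ := h1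
    obtain ⟨t', ht', h2⟩ := h2
    have htN : N ≤ t := ha.trans (Finset.mem_Ico.1 ht).1
    have htN' : N ≤ t' := by
      have := (Finset.mem_Ico.1 ht').1
      omega
    have hcardS : (S.image ray).card = 2 ^ (n + 1) := by
      rw [Finset.card_image_of_injective _ hinj, hS, Nat.card_Ico]
      omega
    have hle : 2 ^ (n + 1) ≤ 2 ^ n₀ := Nat.pow_le_pow_right (by norm_num) hn
    obtain ⟨x, hx, hxu, hxE, hxE'⟩ := exists_center_not_available hφ (S := S.image ray)
      (by
        intro x hx
        obtain ⟨w, -, rfl⟩ := Finset.mem_image.1 (Finset.mem_coe.1 hx)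
        exact hU w)
      (connOn_ray_segment hadj a _) (Finset.mem_image_of_mem ray (hL ht))
      (Finset.mem_image_of_mem ray (hR ht')) (hav t htN) (hav t' htN')
      (by
        have := hE t htN
        have := hE t' htN'
        omega)
    obtain ⟨v, hv, rfl⟩ := Finset.mem_image.1 hx
    have hvu : ∀ w ∈ S, φ (ray w) = φ (ray v) → w = v := fun w hw hwv =>
      hinj (hxu _ (Finset.mem_image_of_mem ray hw) hwv)
    rcases lt_or_ge v (a + 2 ^ n) with hlt | hge
    · exact h2 v (Finset.mem_Ico.2 ⟨(Finset.mem_Ico.1 hv).1, hlt⟩) ⟨hvu, hxE'⟩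
    · refine h1 v (Finset.mem_Ico.2 ⟨hge, ?_⟩) ⟨hvu, hxE⟩
      have := (Finset.mem_Ico.1 hv).2
      omega

/-- Extending availability from the neighbours `W'` of `x` to `x`. -/
lemma Available.of_neighbors {x : V} {W' : Set V} (hW' : W' ⊆ U) (hadj : ∀ y ∈ W', G.Adj x y)
    {E D B : Finset C} {c : C}
    (hy : Recurrent W' fun y => φ y = c ∧ G.Available φ U y E D)
    (hB : ∀ b ∈ B, Recurrent W' fun y => φ y = b) :
    G.Available φ U x (insert c E) (D ∪ B) := by
  intro F D' hD'
  -- Colours of `D' ∩ D` are collected through `y`, at the price of the mandatory colour `c`. The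
  -- remaining ones sit directly on neighbours `z b` of `x`.
  obtain ⟨y, hyW, hyF, hyc, hyA⟩ := hy F
  obtain ⟨Y, hYU, hYF, hYc, hYφ⟩ := hyA F (D' ∩ D) Finset.inter_subset_right
  have hz : ∀ b : C, ∃ z : V, b ∈ D' \ D → z ∈ W' ∧ z ∉ F ∧ φ z = b := by
    intro b
    by_cases hb : b ∈ D' \ D
    · have hbB : b ∈ B := by
        rw [Finset.mem_sdiff] at hb
        exact (Finset.mem_union.1 (hD' hb.1)).resolve_left hb.2
      obtain ⟨z, h1, h2, h3⟩ := hB b hbB F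
      exact ⟨z, fun _ => ⟨h1, h2, h3⟩⟩
    · exact ⟨x, fun h => absurd h hb⟩
  choose z hz using hz
  refine ⟨insert y Y ∪ (D' \ D).image z, ?_, ?_, ?_, ?_⟩
  · intro v hv
    rw [Finset.mem_coe, Finset.mem_union, Finset.mem_insert, Finset.mem_image] at hv
    rcases hv with (rfl | hv) | ⟨b, hb, rfl⟩
    · exact hW' hyW
    · exact hYU hv
    · exact hW' (hz b hb).1
  · rw [Finset.disjoint_left]
    intro v hv
    rw [Finset.mem_union, Finset.mem_insert, Finset.mem_image] at hv
    rcases hv with (rfl | hv) | ⟨b, hb, rfl⟩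
    · exact hyF
    · exact Finset.disjoint_left.1 hYF hv
    · exact (hz b hb).2.1
  · have h1 := (hYc.insert_adj (Or.inl rfl) (hadj y hyW).symm).union_neighbors (Or.inl rfl)
      ((D' \ D).image z) (by
        intro v hv
        obtain ⟨b, hb, rfl⟩ := Finset.mem_image.1 hv
        exact hadj _ (hz b hb).1)
    rwa [Set.insert_union, ← Finset.coe_insert, ← Finset.coe_union] at h1
  · ext b
    simp only [Finset.image_union, Finset.image_insert, Finset.mem_union, Finset.mem_insert, hYφ,
      hyc, Finset.mem_inter, Finset.mem_image, Finset.mem_sdiff]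
    constructor
    · rintro ((rfl | h | h) | ⟨v, ⟨d, hd, rfl⟩, rfl⟩)
      · exact Or.inl (Or.inl rfl)
      · exact Or.inl (Or.inr h)
      · exact Or.inr h.1
      · rw [(hz d (Finset.mem_sdiff.2 hd)).2.2]
        exact Or.inr hd.1
    · rintro ((rfl | h) | h)
      · exact Or.inl (Or.inl rfl)
      · exact Or.inl (Or.inr (Or.inl h))
      · by_cases hb : b ∈ D
        · exact Or.inl (Or.inr (Or.inr ⟨h, hb⟩))
        · exact Or.inr ⟨z b, ⟨b, ⟨h, hb⟩, rfl⟩, (hz b (Finset.mem_sdiff.2 ⟨h, hb⟩)).2.2⟩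

end SimpleGraph

namespace SimpleGraph

variable {V : Type*} {C : Type} [DecidableEq V] [DecidableEq C] {G : SimpleGraph V} {φ : V → C} {U : Set V}

/-- In a rich set, labels `Λ` of the vertices being given together with the colours available at
them, some label recurs and is missed by many recurring colours. -/
lemma exists_recurrent_of_ray [Finite C] {p h n : ℕ} (hφ : G.FinCenteredOn p φ U) {W : Set V}
    (hWU : W ⊆ U) (hW : G.Rich 0 W) {Λ : Type} [Finite Λ] (lab : V → Λ) (E D : Λ → Finset C)
    (hav : ∀ y ∈ W, G.Available φ U y (E (lab y)) (D (lab y)))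
    (hE : ∀ y ∈ W, (E (lab y)).card ≤ h) (hp : 2 ^ n + 2 * h ≤ p) :
    ∃ l : Λ, ∃ B : Finset C, Recurrent W (fun y => lab y = l) ∧
      (∀ c ∈ B, Recurrent W fun y => φ y = c) ∧ n ≤ B.card ∧ Disjoint B (E l ∪ D l) := by
  obtain ⟨ray, hinj, hmem, hadj⟩ := hW
  have hrec : ∀ τ : C × Λ, {s | (φ (ray s), lab (ray s)) = τ}.Infinite →
      Recurrent W fun y => (φ y, lab y) = τ := by
    intro τ hτ F
    obtain ⟨y, ⟨s, hs, rfl⟩, hy⟩ := (hτ.image hinj.injOn).exists_notMem_finset F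
    exact ⟨ray s, hmem s, hy, hs⟩
  -- There are finitely many pairs of colour and label, so far out on the ray only pairs that recur
  -- forever are seen.
  have hev : ∀ τ : C × Λ, ∀ᶠ t in Filter.atTop, (φ (ray t), lab (ray t)) = τ →
      {s | (φ (ray s), lab (ray s)) = τ}.Infinite := by
    intro τ
    by_cases hτ : {s | (φ (ray s), lab (ray s)) = τ}.Infinite
    · exact Filter.Eventually.of_forall fun _ _ => hτ
    · rw [Set.not_infinite] at hτ
      obtain ⟨N, hN⟩ := hτ.bddAbove
      filter_upwards [Filter.eventually_gt_atTop N] with t ht he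
      exact absurd (hN he) (by omega)
  obtain ⟨N, hN⟩ := Filter.eventually_atTop.1 (Filter.eventually_all.2 hev)
  have hN' : ∀ t ≥ N, Recurrent W fun y => (φ y, lab y) = (φ (ray t), lab (ray t)) :=
    fun t ht => hrec _ (hN t ht _ rfl)
  obtain ⟨t, ht, B, hB, hBs, hBd⟩ := exists_hub (N := N) hφ hinj hadj (fun s => hWU (hmem s))
    (fun t => E (lab (ray t))) (fun t => D (lab (ray t))) (fun t _ => hav _ (hmem t))
    (fun t _ => hE _ (hmem t)) hp n le_rfl N le_rfl
  refine ⟨lab (ray t), B, ?_, ?_, hB.ge, hBd⟩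
  · exact (hN' t (Finset.mem_Ico.1 ht).1).mono subset_rfl fun y hy => congrArg Prod.snd hy
  · intro c hc
    obtain ⟨s, hs, rfl⟩ := Finset.mem_image.1 (hBs hc)
    exact (hN' s (Finset.mem_Ico.1 hs).1).mono subset_rfl fun y hy => congrArg Prod.fst hy

/-- Induction on `j`, with `s` rounds at each level. In one round the hypothesis for `j` is applied
to the neighbourhood of each `x`, labels recording what the neighbours can already reach. It yields
a recurring label and `s ^ j * n` colours unavailable there. Passing through a neighbour with that
label makes the old and the new colours available at `x` for one more mandatory colour. The batches
of successive rounds are disjoint, and the mandatory colours stay within `h + j * s`. -/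
lemma exists_recurrent_of_rich [Finite C] {p s n : ℕ} (hs : 1 ≤ s) (hφ : G.FinCenteredOn p φ U)
    (j : ℕ) : ∀ (h : ℕ) (W : Set V), W ⊆ U → G.Rich j W → ∀ (Λ : Type) [Finite Λ]
    (lab : V → Λ) (E D : Λ → Finset C),
    (∀ y ∈ W, G.Available φ U y (E (lab y)) (D (lab y))) →
    (∀ y ∈ W, (E (lab y)).card ≤ h) → 2 ^ n + 2 * (h + j * s) ≤ p →
    ∃ l : Λ, ∃ B : Finset C, Recurrent W (fun y => lab y = l) ∧
      (∀ c ∈ B, Recurrent W fun y => φ y = c) ∧ s ^ j * n ≤ B.card ∧ Disjoint B (E l ∪ D l) := by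
  induction j with
  | zero =>
    intro h W hWU hW Λ _ lab E D hav hE hp
    simpa using exists_recurrent_of_ray hφ hWU hW lab E D hav hE (by simpa using hp)
  | succ j ih =>
    intro h W hWU hW Λ _ lab E D hav hE hp
    obtain ⟨⟨x₀, hx₀⟩, hnb⟩ := hW
    -- The triple `d` holds a label, the mandatory colours added and the optional colours gained in
    -- `i` rounds. The label is that of `x` itself for `i = 0` and recurs in `W` afterwards.
    have claim : ∀ i ≤ s, ∀ x : V, ∃ d : Λ × Finset C × Finset C, x ∈ W →
        (d.2.1 ∪ E d.1).card ≤ h + i ∧ G.Available φ U x (d.2.1 ∪ E d.1) (D d.1 ∪ d.2.2) ∧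
        i * (s ^ j * n) ≤ d.2.2.card ∧ Disjoint d.2.2 (E d.1 ∪ D d.1) ∧
        (i = 0 → d.1 = lab x) ∧ (i ≠ 0 → Recurrent W fun y => lab y = d.1) ∧
        ∀ c ∈ d.2.2, Recurrent W fun y => φ y = c := by
      intro i
      induction i with
      | zero =>
        intro _ x
        refine ⟨(lab x, ∅, ∅), fun hx => ?_⟩
        simp only [Finset.empty_union, Finset.union_empty]
        exact ⟨hE x hx, hav x hx, by simp, by simp, by simp, fun h => absurd rfl h, by simp⟩
      | succ i ihi =>
        intro hi x
        by_cases hx : x ∉ W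
        · exact ⟨(lab x, ∅, ∅), fun h => absurd h hx⟩
        rw [not_not] at hx
        choose d hd using ihi (by omega)
        obtain ⟨W', hW'W, hadj, hrich⟩ := hnb x hx
        -- Since the label includes `φ y` and the whole triple of `y`, one recurring value fixes
        -- both the colour `c₀` paid for the passage and everything reachable behind it. The entry
        -- `l₀` is needed for the first round, where `l` must be shown to recur.
        obtain ⟨⟨l₀, c₀, l, E₂, B⟩, B', hrec, hrecB, hcard, hdis⟩ := ih (h + s) W' (hW'W.trans hWU)
          hrich (Λ × C × Λ × Finset C × Finset C) (fun y => (lab y, φ y, d y))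
          (fun t => t.2.2.2.1 ∪ E t.2.2.1) (fun t => D t.2.2.1 ∪ t.2.2.2.2)
          (fun y hy => (hd y (hW'W hy)).2.1)
          (fun y hy => (hd y (hW'W hy)).1.trans (by omega : h + i ≤ h + s))
          (by
            have : (j + 1) * s = j * s + s := by ring
            omega)
        simp only [Prod.mk.injEq] at hrec hdis
        refine ⟨(l, insert c₀ E₂, B ∪ B'), fun _ => ?_⟩
        obtain ⟨y, hy, -, hyl₀, hyc₀, hyd⟩ := hrec ∅
        obtain ⟨h1, h2, h3, h4, h5, h6, h7⟩ := hd y (hW'W hy)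
        rw [hyd] at h1 h2 h3 h4 h5 h6 h7
        simp only at h1 h2 h3 h4 h5 h6 h7 ⊢
        rw [Finset.disjoint_union_right, Finset.disjoint_union_right,
          Finset.disjoint_union_right] at hdis
        refine ⟨?_, ?_, ?_, ?_, by omega, fun _ => ?_, ?_⟩
        · rw [Finset.insert_union]
          exact (Finset.card_insert_le _ _).trans (by omega)
        · rw [Finset.insert_union, ← Finset.union_assoc]
          refine Available.of_neighbors (hW'W.trans hWU) hadj ?_ hrecB
          intro F
          obtain ⟨z, hz, hzF, -, hzc₀, hzd⟩ := hrec F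
          have hz2 := (hd z (hW'W hz)).2.1
          rw [hzd] at hz2
          exact ⟨z, hz, hzF, hzc₀, hz2⟩
        · rw [Finset.card_union_of_disjoint hdis.2.2.symm, Nat.add_mul, Nat.one_mul]
          omega
        · rw [Finset.disjoint_union_left]
          refine ⟨h4, ?_⟩
          rw [Finset.disjoint_union_right]
          exact ⟨hdis.1.2, hdis.2.1⟩
        · by_cases hi0 : i = 0
          · have : l = l₀ := (h5 hi0).trans hyl₀
            subst this
            exact hrec.mono hW'W fun z hz => hz.1
          · exact h6 hi0
        · intro c hc
          rcases Finset.mem_union.1 hc with hc | hc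
          · exact h7 c hc
          · exact (hrecB c hc).mono hW'W fun z hz => hz
    obtain ⟨⟨l, E₂, B⟩, hd⟩ := claim s le_rfl x₀
    obtain ⟨-, -, h3, h4, -, h6, h7⟩ := hd hx₀
    refine ⟨l, B, h6 (by omega), h7, ?_, h4⟩
    rw [pow_succ, Nat.mul_comm (s ^ j) s, Nat.mul_assoc]
    exact h3

/-- The number of colours in a centered colouring of a rich graph. -/
lemma le_card_of_rich [Fintype C] {p s n j : ℕ} (hs : 1 ≤ s) (hφ : G.FinCenteredOn p φ U)
    (hU : G.Rich j U) (hp : 2 ^ n + 2 * (j * s) ≤ p) : s ^ j * n ≤ Fintype.card C := by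
  obtain ⟨-, B, -, -, hB, -⟩ := exists_recurrent_of_rich (n := n) hs hφ j 0 U subset_rfl hU PUnit
    (fun _ => PUnit.unit) (fun _ => ∅) (fun _ => ∅)
    (by
      intro y _ F D' hD'
      rw [Finset.subset_empty] at hD'
      subst hD'
      exact ⟨∅, by simp, by simp, by simpa using ConnOn.singleton y, by simp⟩)
    (by simp) (by simpa using hp)
  exact hB.trans (Finset.card_le_univ B)

end SimpleGraph

/-! ### The graph of reduced words and its simple treewidth -/

namespace SimpleGraph

variable {α : Type}

/-- The bag of a word: its suffixes whose first letter does not occur before them. -/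
def wordBag (l : List α) : Set (List α) := {v | ∃ a v', v = a :: v' ∧ ∃ u, l = u ++ v ∧ a ∉ u}

/-- Words are adjacent if one belongs to the bag of the other. -/
def wordGraph (α : Type) : SimpleGraph (List α) where
  Adj v w := v ≠ w ∧ (v ∈ wordBag w ∨ w ∈ wordBag v)
  symm := ⟨fun _ _ h => ⟨h.1.symm, h.2.symm⟩⟩
  loopless := ⟨fun _ h => h.1 rfl⟩

/-- Words without equal consecutive letters. -/
def IsReducedWord (l : List α) : Prop := l.IsChain (· ≠ ·)

lemma IsReducedWord.cons {a : α} {l : List α} (h : IsReducedWord l) (ha : ∀ b ∈ l.head?, a ≠ b) :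
    IsReducedWord (a :: l) := List.isChain_cons.2 ⟨ha, h⟩

lemma IsReducedWord.of_append {u l : List α} (h : IsReducedWord (u ++ l)) : IsReducedWord l :=
  (List.isChain_append.1 h).2.1

lemma mem_wordBag_self {l : List α} (h : l ≠ []) : l ∈ wordBag l := by
  obtain ⟨a, l', rfl⟩ := List.exists_cons_of_ne_nil h
  exact ⟨a, l', rfl, [], rfl, by simp⟩

lemma mem_wordBag_append {a : α} {v' u : List α} (h : a ∉ u) : a :: v' ∈ wordBag (u ++ a :: v') :=
  ⟨a, v', rfl, u, rfl, h⟩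

/-- Of two words in a common bag, the shorter one lies in the bag of the longer one. -/
lemma mem_wordBag_of_length_le {l v w : List α} (hv : v ∈ wordBag l) (hw : w ∈ wordBag l)
    (hle : v.length ≤ w.length) : v ∈ wordBag w := by
  obtain ⟨a, v', rfl, u, rfl, hau⟩ := hv
  obtain ⟨b, w', rfl, x, hx, -⟩ := hw
  obtain ⟨y, hy⟩ := List.suffix_of_suffix_length_le (List.suffix_append u (a :: v'))
    ⟨x, hx.symm⟩ hle
  rw [← hy, ← List.append_assoc, List.append_cancel_right_eq] at hx
  rw [← hy]
  refine mem_wordBag_append fun hm => hau ?_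
  rw [hx]
  exact List.mem_append_right _ hm

lemma wordGraph_adj_iff {v w : List α} (hv : v ≠ []) (hw : w ≠ []) :
    (wordGraph α).Adj v w ↔ v ≠ w ∧ ∃ l, v ∈ wordBag l ∧ w ∈ wordBag l := by
  refine and_congr_right fun _ => ⟨?_, ?_⟩
  · rintro (h | h)
    · exact ⟨w, h, mem_wordBag_self hw⟩
    · exact ⟨v, mem_wordBag_self hv, h⟩
  · rintro ⟨l, h1, h2⟩
    rcases le_total v.length w.length with h | h
    · exact Or.inl (mem_wordBag_of_length_le h1 h2 h)
    · exact Or.inr (mem_wordBag_of_length_le h2 h1 h)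

/-- The member of a bag with first letter `a` is the suffix starting at the first occurrence of `a`.
A bag therefore has at most as many members as there are letters. -/
lemma injOn_head_wordBag (l : List α) : Set.InjOn List.head? (wordBag l) := by
  have key : ∀ a : α, ∀ v w u x : List α, u ++ a :: v = x ++ a :: w → a ∉ u → a ∉ x → v = w := by
    intro a v w u
    induction u with
    | nil =>
      rintro (_ | ⟨c, x⟩) h _ hx
      · simpa using h
      · rw [List.nil_append, List.cons_append, List.cons.injEq] at h
        exact absurd (h.1 ▸ List.mem_cons_self) hx
    | cons d u ih =>
      rintro (_ | ⟨c, x⟩) h hu hx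
      · rw [List.nil_append, List.cons_append, List.cons.injEq] at h
        exact absurd (h.1 ▸ List.mem_cons_self) hu
      · rw [List.cons_append, List.cons_append, List.cons.injEq] at h
        exact ih x h.2 (fun hm => hu (List.mem_cons_of_mem _ hm))
          fun hm => hx (List.mem_cons_of_mem _ hm)
  rintro _ ⟨a, v, rfl, u, rfl, hu⟩ _ ⟨b, w, rfl, x, hx, hbx⟩ he
  simp only [List.head?_cons, Option.some.injEq] at he
  subst he
  rw [key a v w u x hx hu hbx]

lemma encard_wordBag_le [Fintype α] (l : List α) : (wordBag l).encard ≤ Fintype.card α := by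
  rw [← (injOn_head_wordBag l).encard_image]
  have hsub : List.head? '' wordBag l ⊆ Set.range (some : α → Option α) := by
    rintro _ ⟨_, ⟨a, v, rfl, -⟩, rfl⟩
    exact ⟨a, rfl⟩
  refine (Set.encard_le_encard hsub).trans ?_
  rw [← Set.image_univ, (Option.some_injective α).encard_image, Set.encard_univ,
    ENat.card_eq_coe_fintype_card]

/-- A set of as many words as there are letters, minus one, lies in at most two bags. -/
lemma encard_wordBag_superset_le [Fintype α] (X : Finset (List α))
    (hX : X.card + 1 = Fintype.card α) (hne : X.Nonempty) :
    {l : List α | IsReducedWord l ∧ (X : Set (List α)) ⊆ wordBag l}.encard ≤ 2 := by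
  classical
  by_cases hemp : {l : List α | IsReducedWord l ∧ (X : Set (List α)) ⊆ wordBag l} = ∅
  · simp [hemp]
  obtain ⟨l₀, -, hl₀⟩ := Set.nonempty_iff_ne_empty.2 hemp
  obtain ⟨v₀, hv₀, hmax⟩ := X.exists_max_image List.length hne
  -- The words of `X` have distinct first letters, so exactly one letter `b` is missing among them.
  obtain ⟨b, hb⟩ : ∃ b : α, ∀ a, a ≠ b → ∃ v ∈ X, v.head? = some a := by
    have h1 : (X.image List.head?).card = X.card :=
      Finset.card_image_of_injOn ((injOn_head_wordBag l₀).mono hl₀)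
    have h2 : X.image List.head? ⊆ Finset.univ.image (some : α → Option α) := by
      intro o ho
      obtain ⟨v, hv, rfl⟩ := Finset.mem_image.1 ho
      obtain ⟨a, v', rfl, -⟩ := hl₀ hv
      simp
    have h3 : (Finset.univ.image (some : α → Option α)).card = Fintype.card α := by
      rw [Finset.card_image_of_injective _ (Option.some_injective α), Finset.card_univ]
    have h4 : (Finset.univ.image (some : α → Option α) \ X.image List.head?).card = 1 := by
      rw [Finset.card_sdiff_of_subset h2, h3, h1]
      omega
    obtain ⟨o, ho⟩ := Finset.card_eq_one.1 h4
    have ho1 : o ∈ Finset.univ.image (some : α → Option α) \ X.image List.head? := by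
      rw [ho]; simp
    obtain ⟨b, -, rfl⟩ := Finset.mem_image.1 (Finset.mem_sdiff.1 ho1).1
    refine ⟨b, fun a hab => ?_⟩
    by_contra! hno
    have : some a ∈ Finset.univ.image (some : α → Option α) \ X.image List.head? := by
      rw [Finset.mem_sdiff]
      refine ⟨by simp, fun hm => ?_⟩
      obtain ⟨v, hv, hva⟩ := Finset.mem_image.1 hm
      exact hno v hv hva
    rw [ho, Finset.mem_singleton, Option.some.injEq] at this
    exact hab this
  have hsub : {l : List α | IsReducedWord l ∧ (X : Set (List α)) ⊆ wordBag l} ⊆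
      {v₀, b :: v₀} := by
    rintro l ⟨hl, hXl⟩
    obtain ⟨a₀, v', hv', u, rfl, hau⟩ := hXl hv₀
    -- Another letter in front of the longest word `v₀` would also precede the word of `X` that it
    -- starts, and expel that word from the bag. Being reduced, `l` has at most one letter `b` in
    -- front of `v₀`.
    have hub : ∀ c ∈ u, c = b := by
      intro c hc
      by_contra hcb
      obtain ⟨v, hv, hvc⟩ := hb c hcb
      obtain ⟨a, w, rfl, x, hx, hax⟩ := hXl hv
      rw [List.head?_cons, Option.some.injEq] at hvc
      subst hvc
      obtain ⟨y, hy⟩ := List.suffix_of_suffix_length_le ⟨x, hx.symm⟩ (List.suffix_append u v₀)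
        (hmax _ hv)
      rw [← hy, ← List.append_assoc, List.append_cancel_right_eq] at hx
      exact hax (hx ▸ List.mem_append_left _ hc)
    match u, hub, hl with
    | [], _, _ => exact Or.inl rfl
    | [c], hub, _ =>
      right
      rw [hub c (by simp)]
      rfl
    | c :: d :: u, hub, hl =>
      rw [List.cons_append, List.cons_append] at hl
      exact absurd ((hub c (by simp)).trans (hub d (by simp)).symm)
        (List.isChain_cons_cons.1 hl).1
  refine (Set.encard_le_encard hsub).trans ((Set.encard_insert_le _ _).trans ?_)
  rw [Set.encard_singleton, one_add_one_eq_two]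

/-- The nodes of the decomposition tree. -/
abbrev WordNode (α : Type) (N : ℕ) : Type := {l : List α // IsReducedWord l ∧ l.length ≤ N}

instance [Finite α] (N : ℕ) : Finite (WordNode α N) :=
  ((List.finite_length_le α N).subset fun _ h => h.2 :
    {l : List α | IsReducedWord l ∧ l.length ≤ N}.Finite).to_subtype

/-- The tree of reduced words of bounded length. -/
def wordTree (α : Type) (N : ℕ) : SimpleGraph (WordNode α N) where
  Adj s t := (∃ c, s.1 = c :: t.1) ∨ ∃ c, t.1 = c :: s.1
  symm := ⟨fun _ _ h => h.symm⟩
  loopless := ⟨by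
    rintro s (⟨c, h⟩ | ⟨c, h⟩) <;> simpa using congrArg List.length h⟩

/-- Sending a non-empty word to the edge towards its tail hits every edge, so there are fewer edges
than nodes; connectedness then makes the graph a tree. -/
lemma wordTree_isTree [Finite α] (N : ℕ) : (wordTree α N).IsTree := by
  have hnil : IsReducedWord ([] : List α) ∧ ([] : List α).length ≤ N :=
    ⟨List.isChain_nil, Nat.zero_le _⟩
  have hreach : ∀ (l : List α) (hl : IsReducedWord l ∧ l.length ≤ N),
      (wordTree α N).Reachable ⟨[], hnil⟩ ⟨l, hl⟩ := by
    intro l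
    induction l with
    | nil => exact fun _ => Reachable.refl _
    | cons a l ih =>
      intro hl
      have hl' : IsReducedWord l ∧ l.length ≤ N :=
        ⟨List.IsChain.tail hl.1, by have := hl.2; simp only [List.length_cons] at this; omega⟩
      refine (ih hl').trans (Adj.reachable ?_)
      exact Or.inr ⟨a, rfl⟩
  have hconn : (wordTree α N).Connected := by
    have : Nonempty (WordNode α N) := ⟨⟨[], hnil⟩⟩
    rw [connected_iff_exists_forall_reachable]
    exact ⟨⟨[], hnil⟩, fun t => hreach t.1 t.2⟩
  rw [isTree_iff_connected_and_card]
  refine ⟨hconn, le_antisymm ?_ hconn.card_vert_le_card_edgeSet_add_one⟩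
  have htail : ∀ t : {t : WordNode α N // t ≠ ⟨[], hnil⟩},
      ∃ e : (wordTree α N).edgeSet, ∃ s : WordNode α N, (e : Sym2 _) = s(t.1, s) ∧
        s.1 = t.1.1.tail := by
    rintro ⟨⟨l, hl⟩, hne⟩
    obtain ⟨a, l', rfl⟩ := List.exists_cons_of_ne_nil (l := l) (by rintro rfl; exact hne rfl)
    have hl' : IsReducedWord l' ∧ l'.length ≤ N :=
      ⟨List.IsChain.tail hl.1, by have := hl.2; simp only [List.length_cons] at this; omega⟩
    exact ⟨⟨s(⟨a :: l', hl⟩, ⟨l', hl'⟩), Or.inl ⟨a, rfl⟩⟩, ⟨l', hl'⟩, rfl, rfl⟩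
  choose e s he hs using htail
  have hsurj : Function.Surjective e := by
    have key : ∀ s' t : WordNode α N, ∀ c, t.1 = c :: s'.1 → ∃ x, (e x : Sym2 _) = s(t, s') := by
      intro s' t c h
      have hne : t ≠ ⟨[], hnil⟩ := by
        rintro rfl
        simp at h
      refine ⟨⟨t, hne⟩, ?_⟩
      rw [he]
      have : s ⟨t, hne⟩ = s' := by
        apply Subtype.ext
        rw [hs, h, List.tail_cons]
      rw [this]
    rintro ⟨x, hx⟩
    induction x using Sym2.ind with
    | _ t s' =>
      rcases hx with ⟨c, h⟩ | ⟨c, h⟩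
      · obtain ⟨x, hx⟩ := key s' t c h
        exact ⟨x, Subtype.ext hx⟩
      · obtain ⟨x, hx⟩ := key t s' c h
        exact ⟨x, Subtype.ext (hx.trans Sym2.eq_swap)⟩
  have h1 := Nat.card_le_card_of_surjective e hsurj
  have h2 : Nat.card {t : WordNode α N // t ≠ ⟨[], hnil⟩} + 1 = Nat.card (WordNode α N) := by
    have := Fintype.ofFinite (WordNode α N)
    classical
    rw [Nat.card_eq_fintype_card, Nat.card_eq_fintype_card, Fintype.card_subtype_compl,
      Fintype.card_subtype_eq]
    have : 0 < Fintype.card (WordNode α N) := Fintype.card_pos_iff.2 ⟨⟨[], hnil⟩⟩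
    omega
  omega

/-- A node whose bag contains `v` is `u ++ v` with the first letter of `v` absent from `u`. Deleting
the letters of `u` one by one leads to `v` without leaving the subtree. -/
lemma wordTree_induce_connected {N : ℕ} {v : List α} (hv : IsReducedWord v ∧ v.length ≤ N)
    (hne : v ≠ []) : ((wordTree α N).induce {t | v ∈ wordBag t.1}).Connected := by
  have hvv : v ∈ wordBag v := mem_wordBag_self hne
  obtain ⟨a, v', rfl⟩ := List.exists_cons_of_ne_nil hne
  have hreach : ∀ (u : List α) (hu : IsReducedWord (u ++ a :: v') ∧ (u ++ a :: v').length ≤ N)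
      (hau : a ∉ u), ((wordTree α N).induce {t | a :: v' ∈ wordBag t.1}).Reachable
        (⟨⟨a :: v', hv⟩, hvv⟩ : {t : WordNode α N | a :: v' ∈ wordBag t.1})
        (⟨⟨u ++ a :: v', hu⟩, mem_wordBag_append hau⟩ :
          {t : WordNode α N | a :: v' ∈ wordBag t.1}) := by
    intro u
    induction u with
    | nil => exact fun _ _ => Reachable.refl _
    | cons c u ih =>
      intro hu hau
      have hu' : IsReducedWord (u ++ a :: v') ∧ (u ++ a :: v').length ≤ N :=
        ⟨List.IsChain.tail hu.1, by
          have := hu.2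
          simp only [List.length_cons, List.cons_append] at this
          omega⟩
      refine (ih hu' fun h => hau (List.mem_cons_of_mem _ h)).trans (Adj.reachable ?_)
      exact Or.inr ⟨c, rfl⟩
  have : Nonempty {t : WordNode α N | a :: v' ∈ wordBag t.1} := ⟨⟨⟨a :: v', hv⟩, hvv⟩⟩
  rw [connected_iff_exists_forall_reachable]
  refine ⟨⟨⟨a :: v', hv⟩, hvv⟩, ?_⟩
  rintro ⟨⟨l, hl⟩, ht⟩
  obtain ⟨b, w, hbw, u, hlu, hbu⟩ := id ht
  rw [List.cons.injEq] at hbw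
  obtain ⟨rfl, rfl⟩ := hbw
  change l = _ at hlu
  subst hlu
  exact hreach u hl hbu

/-- The decomposition of the graph of reduced words of bounded length. -/
def wordDecomposition [Finite α] {V : Type*} {N : ℕ} (e : V → List α)
    (he : ∀ x, e x ≠ [] ∧ IsReducedWord (e x) ∧ (e x).length ≤ N) :
    ((wordGraph α).comap e).TreeDecomposition (WordNode α N) where
  tree := wordTree α N
  isTree := wordTree_isTree N
  bag t := {x | e x ∈ wordBag t.1}
  edge_mem u v h := by
    rcases h.2 with h | h
    · exact ⟨⟨e v, (he v).2⟩, h, mem_wordBag_self (he v).1⟩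
    · exact ⟨⟨e u, (he u).2⟩, mem_wordBag_self (he u).1, h⟩
  connected v := wordTree_induce_connected (he v).2 (he v).1

lemma wordDecomposition_isSimple [Fintype α] {V : Type*} {N k : ℕ} {e : V → List α}
    (hinj : Function.Injective e) (he : ∀ x, e x ≠ [] ∧ IsReducedWord (e x) ∧ (e x).length ≤ N)
    (hk : 1 ≤ k) (hα : Fintype.card α = k + 1) : (wordDecomposition e he).IsSimple k := by
  classical
  constructor
  · intro t
    have h1 : e '' (wordDecomposition e he).bag t ⊆ wordBag t.1 := by
      rintro _ ⟨x, hx, rfl⟩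
      exact hx
    rw [← hinj.encard_image]
    refine (Set.encard_le_encard h1).trans ((encard_wordBag_le t.1).trans ?_)
    rw [hα]
    exact_mod_cast le_rfl
  · intro X hX
    have hXc : (X.image e).card = k := by rw [Finset.card_image_of_injective _ hinj, hX]
    have h1 := encard_wordBag_superset_le (X.image e) (by omega)
      (Finset.card_pos.1 (by omega))
    refine le_trans ?_ h1
    rw [← Subtype.val_injective.encard_image]
    refine Set.encard_le_encard ?_
    rintro _ ⟨t, ht, rfl⟩
    refine ⟨t.2.1, ?_⟩
    intro w hw
    obtain ⟨x, hx, rfl⟩ := Finset.mem_image.1 (Finset.mem_coe.1 hw)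
    exact ht hx

/-- The simple treewidth of the graph of reduced words over `k + 1` letters. -/
lemma simpleTreewidth_wordGraph [Fintype α] {V : Type*} [Finite V] {N k : ℕ} {e : V → List α}
    (hinj : Function.Injective e)
    (he : ∀ l, l ∈ Set.range e ↔ l ≠ [] ∧ IsReducedWord l ∧ l.length ≤ N)
    (hk : 1 ≤ k) (hα : Fintype.card α = k + 1) (hN : k + 1 ≤ N) :
    ((wordGraph α).comap e).simpleTreewidth = k := by
  classical
  have he' : ∀ x, e x ≠ [] ∧ IsReducedWord (e x) ∧ (e x).length ≤ N := fun x => (he _).1 ⟨x, rfl⟩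
  refine le_antisymm ?_ ?_
  · exact iInf₂_le k ⟨hk, WordNode α N, inferInstance, wordDecomposition e he',
      wordDecomposition_isSimple hinj he' hk hα⟩
  -- The `k + 1` non-empty suffixes of a word that lists all letters once share a bag and form a
  -- clique.
  · obtain ⟨l, hlnd, hlen⟩ : ∃ l : List α, l.Nodup ∧ l.length = k + 1 :=
      ⟨Finset.univ.toList, Finset.nodup_toList _, by rw [Finset.length_toList, Finset.card_univ, hα]⟩
    have hlred : IsReducedWord l := List.Pairwise.isChain hlnd
    have hsuf : ∀ i : ℕ, ∃ x : V, i ≤ k → e x = l.drop i ∧ e x ∈ wordBag l := by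
      intro i
      by_cases hi : i ≤ k
      · have hne : l.drop i ≠ [] := by
          rw [Ne, List.drop_eq_nil_iff]
          omega
        obtain ⟨x, hx⟩ := (he (l.drop i)).2 ⟨hne, by
          refine IsReducedWord.of_append (u := l.take i) ?_
          rwa [List.take_append_drop], by rw [List.length_drop]; omega⟩
        refine ⟨x, fun _ => ⟨hx, ?_⟩⟩
        rw [hx]
        obtain ⟨a, w, haw⟩ := List.exists_cons_of_ne_nil hne
        refine ⟨a, w, haw, l.take i, (List.take_append_drop i l).symm, fun ha => ?_⟩
        rw [← List.take_append_drop i l, List.nodup_append] at hlnd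
        exact hlnd.2.2 a ha a (haw ▸ List.mem_cons_self) rfl
      · obtain ⟨x, -⟩ := (he l).2 ⟨by rintro rfl; simp at hlen, hlred, by omega⟩
        exact ⟨x, fun h => absurd h hi⟩
    choose x hx using hsuf
    have hxinj : Set.InjOn x (Finset.range (k + 1) : Set ℕ) := by
      intro i hi j hj hij
      rw [Finset.coe_range, Set.mem_Iio] at hi hj
      have h1 := (hx i (by omega)).1
      have h2 := (hx j (by omega)).1
      rw [hij, h2] at h1
      have := congrArg List.length h1
      rw [List.length_drop, List.length_drop] at this
      omega
    refine le_simpleTreewidth_of_clique ((Finset.range (k + 1)).image x) ?_ ?_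
    · intro y hy z hz hyz
      obtain ⟨i, hi, rfl⟩ := Finset.mem_image.1 (Finset.mem_coe.1 hy)
      obtain ⟨j, hj, rfl⟩ := Finset.mem_image.1 (Finset.mem_coe.1 hz)
      rw [Finset.mem_range] at hi hj
      exact (wordGraph_adj_iff (he' _).1 (he' _).1).2
        ⟨hinj.ne hyz, l, (hx i (by omega)).2, (hx j (by omega)).2⟩
    · rw [Finset.card_image_of_injOn hxinj, Finset.card_range]

end SimpleGraph

/-! ### Compactness, richness of the word graph, and the lower bound -/

namespace SimpleGraph

/-- Centered colourings of the finite parts yield a centered colouring of the whole graph. -/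
lemma exists_finCenteredOn_of_exhaustion {V C : Type*} [DecidableEq C] [Finite C]
    {G : SimpleGraph V} {p : ℕ} {U : Set V} (size : V → ℕ) (N₀ : ℕ)
    (h : ∀ N ≥ N₀, ∃ φ : V → C, G.FinCenteredOn p φ {v | v ∈ U ∧ size v ≤ N}) :
    ∃ φ : V → C, G.FinCenteredOn p φ U := by
  have h' : ∀ N, ∃ φ : V → C, N ≥ N₀ → G.FinCenteredOn p φ {v | v ∈ U ∧ size v ≤ N} := by
    intro N
    by_cases hN : N ≥ N₀
    · obtain ⟨φ, hφ⟩ := h N hN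
      exact ⟨φ, fun _ => hφ⟩
    · obtain ⟨φ, -⟩ := h N₀ le_rfl
      exact ⟨φ, fun h => absurd h hN⟩
  choose ψ hψ using h'
  -- With finitely many colours, the colours of a vertex have a limit along an ultrafilter. On a
  -- finite set the limit colouring agrees with `ψ N` for some arbitrarily large `N`.
  have hlim : ∀ v, ∃ c, ∀ᶠ N in (Filter.hyperfilter ℕ : Filter ℕ), ψ N v = c := by
    intro v
    by_contra! hno
    obtain ⟨N, hN⟩ := (Filter.eventually_all.2 hno).exists
    exact hN _ rfl
  choose φ hφ using hlim
  refine ⟨φ, fun S hSU hne hS => ?_⟩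
  have h1 : ∀ᶠ N in (Filter.hyperfilter ℕ : Filter ℕ), ∀ v ∈ S, ψ N v = φ v :=
    (Filter.eventually_all_finset S).2 fun v _ => hφ v
  have h2 : ∀ᶠ N in (Filter.hyperfilter ℕ : Filter ℕ), max N₀ (S.sup size) ≤ N :=
    Nat.hyperfilter_le_atTop (Filter.eventually_ge_atTop _)
  obtain ⟨N, hN1, hN2⟩ := (h1.and h2).exists
  have himg : S.image (ψ N) = S.image φ := Finset.image_congr fun v hv => hN1 v hv
  rcases hψ N ((le_max_left _ _).trans hN2) S
    (fun v hv => ⟨hSU hv, (Finset.le_sup hv).trans ((le_max_right _ _).trans hN2)⟩) hne hS with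
    h3 | ⟨v, hv, hu⟩
  · left
    rwa [himg] at h3
  · right
    refine ⟨v, hv, fun w hw hwv => hu w hw ?_⟩
    rw [hN1 w hw, hN1 v hv, hwv]

/-- Transporting a centered colouring along an embedding. -/
lemma IsCenteredColoring.exists_finCenteredOn {V V' C : Type*} [DecidableEq C] [Nonempty C]
    {G : SimpleGraph V} {p : ℕ} {e : V' → V} (he : Function.Injective e) {ψ : V' → C}
    (h : (G.comap e).IsCenteredColoring p ψ) :
    ∃ φ : V → C, G.FinCenteredOn p φ (Set.range e) := by
  classical
  refine ⟨Function.extend e ψ fun _ => Classical.arbitrary C, fun S hS hne hc => ?_⟩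
  have himg : e '' (e ⁻¹' (S : Set V)) = S := Set.image_preimage_eq_of_subset hS
  have hconn : (G.comap e).ConnOn (e ⁻¹' (S : Set V)) := by
    rintro A hA ⟨a, ha⟩ ⟨b, hb, hbA⟩
    obtain ⟨x, ⟨x', hx', rfl⟩, y, hy, hxy⟩ := hc (e '' A) (himg ▸ Set.image_mono hA)
      ⟨e a, a, ha, rfl⟩ ⟨e b, hb, fun ⟨c, hc, hcb⟩ => hbA (he hcb ▸ hc)⟩
    obtain ⟨y', rfl⟩ := hS hy.1
    exact ⟨x', hx', y', ⟨hy.1, fun h => hy.2 ⟨y', h, rfl⟩⟩, hxy⟩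
  obtain ⟨v, hv⟩ := hne
  obtain ⟨v', rfl⟩ := hS hv
  rcases (h.centeredOn Set.univ) _ (Set.subset_univ _) ⟨v', hv⟩ hconn with h1 | ⟨w, hw, hu⟩
  · left
    have h2 : ψ '' (e ⁻¹' (S : Set V)) =
        ((S.image (Function.extend e ψ fun _ => Classical.arbitrary C) : Finset C) : Set C) := by
      rw [Finset.coe_image, ← himg, Set.image_image, himg]
      exact Set.image_congr fun x _ => (he.extend_apply ψ _ x).symm
    rw [h2, Set.encard_coe_eq_coe_finsetCard] at h1
    exact_mod_cast h1
  · right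
    refine ⟨e w, hw, fun x hx hxw => ?_⟩
    obtain ⟨x', rfl⟩ := hS hx
    rw [he.extend_apply, he.extend_apply] at hxw
    rw [hu x' hx hxw]

variable {α : Type}

/-- The reduced words that extend `x` by a non-empty word over `A`. -/
def wordCone (A : Finset α) (x : List α) : Set (List α) :=
  {w | IsReducedWord w ∧ ∃ u : List α, u ≠ [] ∧ (∀ c ∈ u, c ∈ A) ∧ w = u ++ x}

/-- The alternating word of length `n`. -/
def alternatingWord (a b : α) : ℕ → List α
  | 0 => []
  | n + 1 => (if n % 2 = 0 then a else b) :: alternatingWord a b n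

/-- A word with first letter `a` is adjacent to all its reduced extensions by letters other than
`a`. Each neighbourhood level thus uses up one letter, and the last two letters give a ray of
alternating words. The head condition keeps the extensions reduced. -/
lemma rich_wordCone [DecidableEq α] (j : ℕ) : ∀ (A : Finset α) (x : List α), A.card = j + 2 → IsReducedWord x →
    (∀ a ∈ x.head?, a ∉ A) → (wordGraph α).Rich j (wordCone A x) := by
  induction j with
  | zero =>
    intro A x hA hx hxA
    obtain ⟨a, b, hab, rfl⟩ := Finset.card_eq_two.1 hA
    have hletter : ∀ n, (if n % 2 = 0 then a else b) ∈ ({a, b} : Finset α) := by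
      intro n
      split_ifs <;> simp
    have hne : ∀ n, (if (n + 1) % 2 = 0 then a else b) ≠ if n % 2 = 0 then a else b := by
      intro n
      rcases Nat.mod_two_eq_zero_or_one n with h | h
      · have h' : (n + 1) % 2 = 1 := by omega
        simpa [h, h'] using hab.symm
      · have h' : (n + 1) % 2 = 0 := by omega
        simpa [h, h'] using hab
    have hlen : ∀ n, (alternatingWord a b n).length = n := by
      intro n
      induction n with
      | zero => rfl
      | succ n ih => rw [alternatingWord, List.length_cons, ih]
    have hred : ∀ n, IsReducedWord (alternatingWord a b n ++ x) := by
      intro n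
      induction n with
      | zero => exact hx
      | succ n ih =>
        rw [alternatingWord, List.cons_append]
        refine ih.cons fun d hd => ?_
        rcases n with _ | n
        · rintro rfl
          exact hxA _ hd (hletter 0)
        · rw [alternatingWord, List.cons_append, List.head?_cons, Option.mem_some_iff] at hd
          rw [← hd]
          exact hne n
    have hmem : ∀ n, ∀ c ∈ alternatingWord a b n, c ∈ ({a, b} : Finset α) := by
      intro n
      induction n with
      | zero => simp [alternatingWord]
      | succ n ih =>
        intro c hc
        rw [alternatingWord, List.mem_cons] at hc
        rcases hc with rfl | hc
        · exact hletter n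
        · exact ih c hc
    have hinj : Function.Injective fun n => alternatingWord a b (n + 1) ++ x := by
      intro m n hmn
      have := congrArg List.length hmn
      simp only [List.length_append, hlen] at this
      omega
    refine ⟨_, hinj, fun n => ⟨hred _, _, by simp [alternatingWord], hmem _, rfl⟩, fun n => ?_⟩
    refine ⟨fun h => by simpa using hinj h, Or.inl ?_⟩
    exact mem_wordBag_append (a := if n % 2 = 0 then a else b) (v' := alternatingWord a b n ++ x)
      (u := [if (n + 1) % 2 = 0 then a else b]) fun h => hne n (List.mem_singleton.1 h).symm
  | succ j ih =>
    intro A x hA hx hxA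
    constructor
    · obtain ⟨a, ha⟩ := Finset.card_pos.1 (by omega : 0 < A.card)
      refine ⟨[a] ++ x, hx.cons fun b hb => ?_, [a], by simp, by simpa using ha, rfl⟩
      rintro rfl
      exact hxA _ hb ha
    · rintro _ ⟨hw, u, hu, huA, rfl⟩
      obtain ⟨a, u, rfl⟩ := List.exists_cons_of_ne_nil hu
      refine ⟨wordCone (A.erase a) (a :: u ++ x), ?_, ?_, ih _ _ ?_ hw ?_⟩
      · rintro _ ⟨hw', t, ht, htA, rfl⟩
        refine ⟨hw', t ++ (a :: u), by simp, fun c hc => ?_, by simp⟩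
        rcases List.mem_append.1 hc with hc | hc
        · exact Finset.mem_of_mem_erase (htA c hc)
        · exact huA c hc
      · rintro _ ⟨hw', t, ht, htA, rfl⟩
        refine ⟨fun h => ?_, Or.inl ?_⟩
        · have := congrArg List.length h
          simp only [List.length_append] at this
          have h0 := List.length_pos_iff.2 ht
          omega
        · rw [List.cons_append]
          exact mem_wordBag_append fun h => Finset.notMem_erase a A (htA a h)
      · rw [Finset.card_erase_of_mem (huA a (by simp)), hA]
        omega
      · intro b hb
        rw [List.cons_append, List.head?_cons, Option.mem_some_iff] at hb
        rw [← hb]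
        exact Finset.notMem_erase a A

lemma wordCone_univ [Fintype α] :
    wordCone (Finset.univ : Finset α) [] = {l | l ≠ [] ∧ IsReducedWord l} := by
  ext l
  constructor
  · rintro ⟨h, u, hu, -, rfl⟩
    exact ⟨by simpa using hu, h⟩
  · rintro ⟨h1, h2⟩
    exact ⟨h2, l, h1, fun c _ => Finset.mem_univ c, by simp⟩

lemma exists_word_enumeration (α : Type) [Finite α] (N : ℕ) : ∃ (n : ℕ) (e : Fin n → List α),
    Function.Injective e ∧ ∀ l, l ∈ Set.range e ↔ l ≠ [] ∧ IsReducedWord l ∧ l.length ≤ N := by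
  have hfin : {l : List α | l ≠ [] ∧ IsReducedWord l ∧ l.length ≤ N}.Finite :=
    (List.finite_length_le α N).subset fun l h => h.2.2
  have := hfin.to_subtype
  obtain ⟨n, ⟨f⟩⟩ := Finite.exists_equiv_fin {l : List α | l ≠ [] ∧ IsReducedWord l ∧ l.length ≤ N}
  refine ⟨n, fun i => (f.symm i : List α), Subtype.val_injective.comp f.symm.injective, fun l => ?_⟩
  constructor
  · rintro ⟨i, rfl⟩
    exact (f.symm i).2
  · intro h
    exact ⟨f ⟨l, h⟩, by simp⟩

/-- Some graph of simple treewidth `k` needs many colours. -/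
lemma exists_graph_needing_colors {k p s n : ℕ} (hk : 1 ≤ k) (hs : 1 ≤ s)
    (hp : 2 ^ n + 2 * ((k - 1) * s) ≤ p) :
    ∃ (N : ℕ) (G : SimpleGraph (Fin N)), G.simpleTreewidth = (k : ℕ∞) ∧
      ∀ (m : ℕ) (φ : Fin N → Fin m), G.IsCenteredColoring p φ → 1 ≤ m ∧ s ^ (k - 1) * n ≤ m := by
  by_contra! hno
  choose num e hinj hrange using exists_word_enumeration (Fin (k + 1))
  have htw : ∀ N ≥ k + 1, ((wordGraph (Fin (k + 1))).comap (e N)).simpleTreewidth = k :=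
    fun N hN => simpleTreewidth_wordGraph (hinj N) (hrange N) hk (Fintype.card_fin _) hN
  have hpos : ∀ N ≥ k + 1, 0 < num N := by
    intro N hN
    obtain ⟨i, -⟩ := (hrange N [0]).2 ⟨by simp, List.isChain_singleton _, by simp; omega⟩
    exact i.pos
  -- One colour fewer than the claimed bound: the negated claim colours every truncation with at
  -- most `M` colours.
  obtain ⟨M, hM⟩ : ∃ M, M + 1 = s ^ (k - 1) * n := by
    obtain ⟨m, φ, -, hm⟩ := hno _ _ (htw (k + 1) le_rfl)
    have h1 : 1 ≤ m := (φ ⟨0, hpos _ le_rfl⟩).pos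
    exact ⟨_, Nat.sub_add_cancel (by have := hm h1; omega)⟩
  have hcol : ∀ N ≥ k + 1, ∃ φ : List (Fin (k + 1)) → Fin M,
      (wordGraph (Fin (k + 1))).FinCenteredOn p φ
        {l | l ∈ wordCone (Finset.univ : Finset (Fin (k + 1))) [] ∧ l.length ≤ N} := by
    intro N hN
    obtain ⟨m, φ, hφ, hm⟩ := hno _ _ (htw N hN)
    have h1 : 1 ≤ m := (φ ⟨0, hpos N hN⟩).pos
    have hmM : m ≤ M := by
      have := hm h1
      omega
    have : Nonempty (Fin M) := ⟨⟨0, by omega⟩⟩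
    have hφ' : ((wordGraph (Fin (k + 1))).comap (e N)).IsCenteredColoring p
        (Fin.castLE hmM ∘ φ) :=
      ((hφ.centeredOn Set.univ).comp_injective (Fin.castLE_injective hmM)).isCenteredColoring
    obtain ⟨ψ, hψ⟩ := hφ'.exists_finCenteredOn (hinj N)
    refine ⟨ψ, ?_⟩
    convert hψ using 1
    ext l
    rw [hrange, wordCone_univ]
    simp only [Set.mem_ofPred_eq, and_assoc]
  obtain ⟨φ, hφ⟩ := exists_finCenteredOn_of_exhaustion List.length (k + 1) hcol
  have hrich := rich_wordCone (k - 1) (Finset.univ : Finset (Fin (k + 1))) []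
    (by rw [Finset.card_univ, Fintype.card_fin]; omega) List.isChain_nil (by simp)
  have := le_card_of_rich hs hφ hrich hp
  rw [Fintype.card_fin] at this
  omega

/-- The lower bound: `Ω(p ^ (k - 1) * log p)` colours may be necessary. -/
lemma exists_lower_bound (k : ℕ) (hk : 2 ≤ k) :
    ∃ c : ℝ, 0 < c ∧ ∀ p : ℕ, 2 ≤ p →
      ∃ (n : ℕ) (G : SimpleGraph (Fin n)), G.simpleTreewidth = (k : ℕ∞) ∧
        ∀ (m : ℕ) (φ : Fin n → Fin m), G.IsCenteredColoring p φ →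
          c * ((p : ℝ) ^ (k - 1) * Real.log (p : ℝ)) ≤ (m : ℝ) := by
  have hk' : (2 : ℝ) ≤ k := by exact_mod_cast hk
  have hlog2 : 0 < Real.log 2 := Real.log_pos (by norm_num)
  have hlogk : 0 < Real.log (4 * k) := Real.log_pos (by linarith)
  -- The constant `c₁` serves `p ≥ 4 * k`, through `s ≥ p / (8 * k)` and `n ≥ log p / (3 * log 2)`.
  -- For smaller `p` the constant `c₂` lowers the claim to at least one colour.
  set c₁ : ℝ := 1 / ((8 * k) ^ (k - 1) * (3 * Real.log 2)) with hc₁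
  set c₂ : ℝ := 1 / ((4 * k) ^ (k - 1) * Real.log (4 * k)) with hc₂
  have hc₁pos : 0 < c₁ := by positivity
  have hc₂pos : 0 < c₂ := by positivity
  refine ⟨min c₁ c₂, lt_min hc₁pos hc₂pos, fun p hp => ?_⟩
  have hp' : (2 : ℝ) ≤ p := by exact_mod_cast hp
  have hlogp : 0 < Real.log p := Real.log_pos (by linarith)
  rcases lt_or_ge p (4 * k) with hlt | hge
  -- Only a non-empty graph of simple treewidth `k` is needed, so the parameters are trivial and the
  -- auxiliary `p` is unrelated to the given one. The clause `1 ≤ m` rules out the empty graph,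
  -- which can be coloured with no colours.
  · obtain ⟨N, G, hG, hm⟩ := exists_graph_needing_colors (k := k) (s := 1) (n := 0)
      (p := 1 + 2 * ((k - 1) * 1)) (by omega) le_rfl (by simp)
    refine ⟨N, G, hG, fun m φ _ => ?_⟩
    have h1 : 1 ≤ m := by
      obtain ⟨s, -⟩ : ∃ _ : Fin N, True := by
        by_contra! hemp
        have h0 : N = 0 := by
          by_contra h0
          exact (hemp ⟨0, by omega⟩).elim
        subst h0
        have := (hm 0 Fin.elim0 (by
          intro H hH
          obtain ⟨v, -⟩ := hH.nonempty
          exact v.elim0)).1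
        omega
      exact (φ s).pos
    have h2 : (p : ℝ) ≤ 4 * k := by exact_mod_cast hlt.le
    have h3 : (p : ℝ) ^ (k - 1) * Real.log p ≤ (4 * k) ^ (k - 1) * Real.log (4 * k) := by
      gcongr
    calc min c₁ c₂ * ((p : ℝ) ^ (k - 1) * Real.log p)
        ≤ c₂ * ((4 * k) ^ (k - 1) * Real.log (4 * k)) := by
          gcongr
          exact min_le_right _ _
      _ = 1 := by
          rw [hc₂]
          field_simp
      _ ≤ m := by exact_mod_cast h1
  -- The budget is split evenly: `2 ^ n` and `2 * ((k - 1) * s)` are each at most `p / 2`.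
  · set s := p / (4 * k) with hs
    set n := Nat.log 2 (p / 2) with hn
    have hs1 : 1 ≤ s := (Nat.one_le_div_iff (by omega)).2 hge
    have hsp : 4 * k * s ≤ p := Nat.mul_div_le p (4 * k)
    have hn2 : 2 ^ n ≤ p / 2 := Nat.pow_log_le_self 2 (by omega)
    have hn3 : p / 2 < 2 ^ (n + 1) := Nat.lt_pow_succ_log_self (by norm_num) _
    have hn1 : 1 ≤ n := by
      rw [hn]
      exact Nat.le_log_of_pow_le (by norm_num) (by omega)
    obtain ⟨N, G, hG, hm⟩ := exists_graph_needing_colors (k := k) (s := s) (n := n) (p := p)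
      (by omega) hs1 (by
        have h1 : (k - 1) * s ≤ k * s := Nat.mul_le_mul_right _ (by omega)
        have h2 : 4 * k * s = 4 * (k * s) := by ring
        omega)
    refine ⟨N, G, hG, fun m φ hφ => ?_⟩
    have h1 := (hm m φ hφ).2
    have h2 : (p : ℝ) / (8 * k) ≤ s := by
      rw [div_le_iff₀ (by positivity)]
      have h3 : p < 4 * k * (s + 1) := Nat.lt_mul_div_succ p (by omega)
      have h4 : p ≤ s * (8 * k) := by
        have : 4 * k * 1 ≤ 4 * k * s := Nat.mul_le_mul_left _ hs1
        nlinarith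
      exact_mod_cast h4
    have h3 : Real.log p / (3 * Real.log 2) ≤ n := by
      rw [div_le_iff₀ (by positivity)]
      have h4 : p ≤ 2 ^ (n + 2) := by
        have : 2 ^ (n + 2) = 2 * 2 ^ (n + 1) := by ring
        omega
      have h5 : Real.log p ≤ Real.log (2 ^ (n + 2)) :=
        Real.log_le_log (by linarith) (by exact_mod_cast h4)
      rw [Real.log_pow] at h5
      push_cast at h5
      have h6 : (1 : ℝ) ≤ n := by exact_mod_cast hn1
      nlinarith
    calc min c₁ c₂ * ((p : ℝ) ^ (k - 1) * Real.log p)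
        ≤ c₁ * ((p : ℝ) ^ (k - 1) * Real.log p) := by
          gcongr
          exact min_le_left _ _
      _ = (p / (8 * k)) ^ (k - 1) * (Real.log p / (3 * Real.log 2)) := by
          rw [hc₁, div_pow]
          field_simp
      _ ≤ s ^ (k - 1) * n := by gcongr
      _ ≤ m := by exact_mod_cast h1

end SimpleGraph

theorem theorem7 (k : ℕ) (hk : 2 ≤ k) :
    (∃ C : ℝ, 0 < C ∧ ∀ p : ℕ, 2 ≤ p →
      ∀ (V : Type*) [Finite V] (G : SimpleGraph V), G.simpleTreewidth ≤ (k : ℕ∞) →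
        ∃ (m : ℕ) (φ : V → Fin m), G.IsCenteredColoring p φ ∧
          (m : ℝ) ≤ C * ((p : ℝ) ^ (k - 1) * Real.log (p : ℝ))) ∧
    (∃ c : ℝ, 0 < c ∧ ∀ p : ℕ, 2 ≤ p →
      ∃ (n : ℕ) (G : SimpleGraph (Fin n)), G.simpleTreewidth = (k : ℕ∞) ∧
        ∀ (m : ℕ) (φ : Fin n → Fin m), G.IsCenteredColoring p φ →
          c * ((p : ℝ) ^ (k - 1) * Real.log (p : ℝ)) ≤ (m : ℝ)) :=
  ⟨SimpleGraph.exists_upper_bound k hk, SimpleGraph.exists_lower_bound k hk⟩
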